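/- \textbf{Conventions.} All alphabets are finite, all Hilbert spaces are finite dimensional, and $\log$ is to base $2$. A subnormalised density matrix is a positive semidefinite matrix of trace at most $1$. Write $\|A\|_1=\mathrm{Tr}\sqrt{A^\dagger A}$ and $\|A\|_2=\sqrt{\mathrm{Tr}(A^\dagger A)}$. For positive semidefinite $\alpha,\beta$ on the same space put $$D_2(\alpha\|\beta)=2\log\|\beta^{-1/4}\alpha\beta^{-1/4}\|_2\ \text{ if } \mathrm{supp}(\alpha)\subseteq\mathrm{supp}(\beta),\qquad D_2(\alpha\|\beta)=+\infty\ \text{ otherwise},$$ where negative powers are taken on the support (Moore--Penrose pseudoinverse). For $0<\epsilon<1$ put $$D_2^\epsilon(\alpha\|\beta)=\min_{\alpha'}D_2(\alpha'\|\beta),$$ the minimum being over all subnormalised density matrices $\alpha'$ with $\|\alpha'-\alpha\|_1\le\epsilon\,\mathrm{Tr}\,\alpha$. \textbf{Proposition (smooth multipartite classical-quantum soft covering in expectation).} Let $k\ge 1$, let $X_1,\dots,X_k$ be finite alphabets, let $M$ be a finite-dimensional Hilbert space, and let $0<\epsilon<1$. Let $p$ be a probability distribution on $X_{[k]}=X_1\times\cdots\times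 X_k$ and let $q^{X_i}$ be a probability distribution on $X_i$ for each $i$, such that the support of the marginal $p^{X_i}$ is contained in the support of $q^{X_i}$. For each $x=(x_1,\dots,x_k)\in X_{[k]}$ let $\rho^M_x$ be a subnormalised density matrix on $M$. Define the control state $$\rho=\rho^{X_{[k]}M}=\sum_{x\in X_{[k]}}p(x)\,|x\rangle\langle x|\otimes\rho^M_x$$ and assume $\mathrm{Tr}\,\rho>0$. For $S\subseteq[k]$ let $\rho^{X_SM}$ and $\rho^M$ be its reduced states on $X_SM$ and on $M$, and let $q^{X_S}=\prod_{s\in S}q^{X_s}$, regarded as a diagonal density matrix. Let $A_1,\dots,A_k$ be positive integers. For tuples $x_i^{(A_i)}=(x_i(1),\dots,x_i(A_i))\in X_i^{A_i}$, $i\in[k]$, define the sample average covering state $$\sigma^M_{x_1^{(A_1)},\dots,x_k^{(A_k)}}=\frac1{A_1\cdots A_k}\sum_{a_1=1}^{A_1}\cdots\sum_{a_k=1}^{A_k}\frac{p(x_1(a_1),\dots,x_k(a_k))}{q^{X_1}(x_1(a_1))\cdots q^{X_k}(x_k(a_k))}\,\rho^M_{x_1(a_1),\dots,x_k(a_k)}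 .$$ Suppose that for every non-empty $S\subseteq[k]$ $$\sum_{s\in S}\log A_s>D_2^\epsilon\bigl(\rho^{X_SM}\,\big\|\,q^{X_S}\otimes\rho^M\bigr)+\log\epsilon^{-2}+\log(\mathrm{Tr}\,\rho)^{-1}.$$ (The last term vanishes when $\mathrm{Tr}\,\rho=1$.) Then $$\mathbb{E}\Bigl[\bigl\|\sigma^M_{x_1^{(A_1)},\dots,x_k^{(A_k)}}-\rho^M\bigr\|_1\Bigr]<2(3^k-1)\,\epsilon\,\mathrm{Tr}\,\rho,$$ where all the entries $x_i(a)$, $i\in[k]$, $a\in[A_i]$, are independent and $x_i(a)$ has distribution $q^{X_i}$. -/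

import Mathlib

open scoped Kronecker ComplexOrder

noncomputable section

namespace SoftCovering

/-! ## Matrices, norms and Rényi-2 divergences -/

section Matrices

variable {n : Type*} [Fintype n] [DecidableEq n]

/-- A subnormalised density matrix: positive semidefinite with trace at most one. -/
def IsSubnormalised (α : Matrix n n ℂ) : Prop :=
  α.PosSemidef ∧ α.trace.re ≤ 1

/-- The Schatten 1-norm `Tr √(A†A)`. -/
def schattenOne (A : Matrix n n ℂ) : ℝ :=
  (cfc Real.sqrt (A.conjTranspose * A)).trace.re

/-- The Schatten 2-norm `√(Tr (A†A))`. -/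
def schattenTwo (A : Matrix n n ℂ) : ℝ :=
  Real.sqrt (A.conjTranspose * A).trace.re

/-- The support of a Hermitian matrix (the span of its eigenvectors with nonzero eigenvalue),
that is, its range. -/
def supp (A : Matrix n n ℂ) : Submodule ℂ (n → ℂ) :=
  LinearMap.range (Matrix.toLin' A)

/-- `β ^ (-1/4)` for positive semidefinite `β`, in the sense of the Moore-Penrose pseudoinverse:
the inverse fourth root on the support of `β` and zero on its orthogonal complement. -/
def invFourthRoot (β : Matrix n n ℂ) : Matrix n n ℂ :=
  cfc (fun t : ℝ => if t = 0 then 0 else t ^ (-(1 / 4) : ℝ)) β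

/-- The (non-smooth) Rényi-2 divergence
`D₂(α‖β) = 2 log₂ ‖β^(-1/4) α β^(-1/4)‖₂` if `supp α ≤ supp β`, and `+∞` otherwise;
here `log₂ 0 = -∞`. -/
def renyiTwo (α β : Matrix n n ℂ) : EReal :=
  open scoped Classical in
  if supp α ≤ supp β then
    if schattenTwo (invFourthRoot β * α * invFourthRoot β) = 0 then ⊥
    else ((2 * Real.logb 2 (schattenTwo (invFourthRoot β * α * invFourthRoot β)) : ℝ) : EReal)
  else ⊤

/-- The `ε`-smooth Rényi-2 divergence: the infimum of `D₂(α'‖β)` over all subnormalised density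
matrices `α'` with `‖α' - α‖₁ ≤ ε Tr α`. -/
def smoothRenyiTwo (ε : ℝ) (α β : Matrix n n ℂ) : EReal :=
  ⨅ α' ∈ {α' : Matrix n n ℂ | IsSubnormalised α' ∧ schattenOne (α' - α) ≤ ε * α.trace.re},
    renyiTwo α' β

end Matrices

/-! ## Classical-quantum states on `X₁ ⋯ X_k M` -/

section States

variable {k : ℕ} {X : Fin k → Type*} [∀ i, Fintype (X i)] [∀ i, DecidableEq (X i)]
variable {m : Type*} [Fintype m] [DecidableEq m]

/-- The marginal on the `i`-th alphabet of a function `p` on the product alphabet. -/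
def marginal (p : (∀ i, X i) → ℝ) (i : Fin k) (a : X i) : ℝ :=
  ∑ x : (∀ i, X i) with x i = a, p x

/-- The control state `∑ₓ p(x) |x⟩⟨x| ⊗ ρₓ`. -/
def controlState (p : (∀ i, X i) → ℝ) (ρ : (∀ i, X i) → Matrix m m ℂ) :
    Matrix ((∀ i, X i) × m) ((∀ i, X i) × m) ℂ :=
  ∑ x, (p x : ℂ) • (Matrix.single x x (1 : ℂ) ⊗ₖ ρ x)

/-- The reduced state on `X_S M`: the partial trace over the registers `X_i`, `i ∉ S`. -/
def reduceTo (S : Finset (Fin k)) (R : Matrix ((∀ i, X i) × m) ((∀ i, X i) × m) ℂ) :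
    Matrix ((∀ i : {i // i ∈ S}, X i) × m) ((∀ i : {i // i ∈ S}, X i) × m) ℂ :=
  Matrix.of fun u v => ∑ z : (∀ i : {i // i ∉ S}, X i),
    R ((Equiv.piEquivPiSubtypeProd (· ∈ S) X).symm (u.1, z), u.2)
      ((Equiv.piEquivPiSubtypeProd (· ∈ S) X).symm (v.1, z), v.2)

/-- The reduced state on `M`: the partial trace over all registers `X_i`. -/
def reduceToM (R : Matrix ((∀ i, X i) × m) ((∀ i, X i) × m) ℂ) : Matrix m m ℂ :=
  Matrix.of fun a b => ∑ x : (∀ i, X i), R (x, a) (x, b)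

/-- The product distribution `q^{X_S} = ×_{s ∈ S} q_s` as a diagonal density matrix. -/
def productState (q : ∀ i, X i → ℝ) (S : Finset (Fin k)) :
    Matrix (∀ i : {i // i ∈ S}, X i) (∀ i : {i // i ∈ S}, X i) ℂ :=
  Matrix.diagonal fun y => ((∏ s : {i // i ∈ S}, q s (y s) : ℝ) : ℂ)

/-- The sample average covering state of the tuples
`x i = (x_i(1), …, x_i(A_i))`, with the change of measure from `∏ q_i` to `p`. -/
def sampleAverage (p : (∀ i, X i) → ℝ) (q : ∀ i, X i → ℝ) (ρ : (∀ i, X i) → Matrix m m ℂ)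
    (A : Fin k → ℕ) (x : ∀ i, Fin (A i) → X i) : Matrix m m ℂ :=
  ((∏ i, (A i : ℂ))⁻¹) • ∑ a : (∀ i, Fin (A i)),
    ((p (fun i => x i (a i)) / ∏ i, q i (x i (a i)) : ℝ) : ℂ) • ρ (fun i => x i (a i))

/-- The expectation of `f` over independent tuples `x i`, each consisting of `A i` independent
samples from `q i`. -/
def expectIID (q : ∀ i, X i → ℝ) (A : Fin k → ℕ) (f : (∀ i, Fin (A i) → X i) → ℝ) : ℝ :=
  ∑ x : (∀ i, Fin (A i) → X i), (∏ i, ∏ j, q i (x i j)) * f x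

end States

end SoftCovering

end

/-! The proof is a second-moment argument on the Hoeffding (ANOVA) decomposition of `f y = p(y)/q(y)
• ρ_y`, whose mean under the product law is `ρ^M`. Write `f` as the sum over `S ⊆ [k]` of components
`f_S` that depend only on the coordinates in `S` and average to zero in each of them. The empty
component is the mean, so `σ - ρ^M` is the sum over non-empty `S` of the sample averages of `f_S`
(`tupleAverage_sub_mean`), and each `S` can be treated with its own rate condition.

Fix `S`. The component `f_S` sees `f` only through its conditional average on `X_S`, which is the
block of `ρ^{X_S M}` divided by `q^{X_S}`. Replace that state by a near-optimal smoothing `α`. The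
replacement costs at most `2^|S| ‖α - ρ^{X_S M}‖₁ ≤ 2^|S| ε Tr ρ`, by the triangle inequality over
the `2^|S|` terms defining a component. For the smoothed part, `traceSeminorm_le_sqrt_mul` passes
from the trace norm to the 2-norm weighted by `(ρ^M)^(-1/4)`, at the price of `√(Tr ρ)`. In the
second moment, index tuples `a`, `b` that differ somewhere on `S` are uncorrelated
(`expectIID_inner_eq_zero`), which gains the factor `1 / ∏_{s ∈ S} A_s`
(`expectIID_norm_sq_average_le`). What remains is at most `4^|S|` times `2^(D₂)`, and the rate
condition makes this part smaller than `2^|S| ε Tr ρ`.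

Both parts are collected in `expectIID_component_le`. Summing `2 · 2^|S| ε Tr ρ` over non-empty `S`
gives `2(3^k - 1) ε Tr ρ` by the binomial theorem. -/

noncomputable section

set_option linter.unusedSectionVars false

namespace SoftCovering

/-! ### Hoeffding decomposition on a finite product probability space. -/

section Product

variable {ι : Type*} [Fintype ι] [DecidableEq ι] {X : ι → Type*} [∀ i, Fintype (X i)]
variable {E : Type*} [AddCommGroup E] [Module ℝ E]

/-- The product weight `∏ i, q i (y i)`. -/
def weight (q : ∀ i, X i → ℝ) (y : ∀ i, X i) : ℝ := ∏ i, q i (y i)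

/-- Averaging of `f` over the coordinates outside `T`. -/
def average (q : ∀ i, X i → ℝ) (T : Finset ι) (f : (∀ i, X i) → E) (x : ∀ i, X i) : E :=
  ∑ z, weight q z • f (T.piecewise x z)

/-- The Hoeffding component of `f` on the coordinates in `S`. -/
def hoeffding (q : ∀ i, X i → ℝ) (S : Finset ι) (f : (∀ i, X i) → E) (x : ∀ i, X i) : E :=
  ∑ T ∈ S.powerset, (-1 : ℝ) ^ (S \ T).card • average q T f x

variable {q : ∀ i, X i → ℝ}

lemma weight_nonneg (hq : ∀ i a, 0 ≤ q i a) (y : ∀ i, X i) : 0 ≤ weight q y :=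
  Finset.prod_nonneg fun i _ => hq i _

lemma sum_weight (hq : ∀ i, ∑ a, q i a = 1) : ∑ y, weight q y = 1 := by
  classical
  simp only [weight]
  rw [← Fintype.prod_sum]
  simp [hq]

/-- Resampling one coordinate preserves the product law: split coordinate `i` off, and the old value
sums to one. -/
lemma sum_weight_update (hq : ∀ i, ∑ a, q i a = 1) (i : ι) (f : (∀ i, X i) → E) :
    ∑ y, weight q y • ∑ a, q i a • f (Function.update y i a) = ∑ y, weight q y • f y := by
  have key : ∀ g : (∀ i, X i) → E, ∑ y, weight q y • g y =
      ∑ r : (∀ j : {j // j ≠ i}, X j), ∑ a, ((∏ j : {j // j ≠ i}, q j (r j)) * q i a) •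
        g ((Equiv.piSplitAt i X).symm (a, r)) := by
    intro g
    rw [← (Equiv.piSplitAt i X).symm.sum_comp, Fintype.sum_prod_type_right]
    refine Finset.sum_congr rfl fun r _ => Finset.sum_congr rfl fun a _ => ?_
    congr 1
    rw [weight, ← Finset.prod_erase_mul _ _ (Finset.mem_univ i)]
    congr 1
    · rw [Finset.prod_subtype (p := fun j => j ≠ i) _ (by simp)]
      refine Finset.prod_congr rfl fun j _ => ?_
      simp [Equiv.piSplitAt, j.2]
    · simp [Equiv.piSplitAt]
  rw [key, key]
  refine Finset.sum_congr rfl fun r _ => ?_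
  have h : ∀ a b, Function.update ((Equiv.piSplitAt i X).symm (a, r)) i b
      = (Equiv.piSplitAt i X).symm (b, r) := by
    intro a b
    ext j
    by_cases hj : j = i
    · subst hj; simp [Equiv.piSplitAt]
    · simp [Equiv.piSplitAt, hj]
  simp only [h]
  rw [← Finset.sum_smul, ← Finset.mul_sum, hq, mul_one, Finset.smul_sum]
  simp only [smul_smul]

lemma sum_sum_weight_piecewise (hq : ∀ i, ∑ a, q i a = 1) (T : Finset ι) (f : (∀ i, X i) → E) :
    ∑ y, weight q y • ∑ z, weight q z • f (T.piecewise y z) = ∑ y, weight q y • f y := by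
  -- Exchanging the coordinates outside `T` between two independent copies preserves their joint
  -- weight.
  have hinv : Function.Involutive (fun p : (∀ i, X i) × (∀ i, X i) =>
      (T.piecewise p.1 p.2, T.piecewise p.2 p.1)) := by
    rintro ⟨y, z⟩
    ext i <;> by_cases hi : i ∈ T <;> simp [hi]
  have hw : ∀ p : (∀ i, X i) × (∀ i, X i),
      weight q (T.piecewise p.1 p.2) * weight q (T.piecewise p.2 p.1)
        = weight q p.1 * weight q p.2 := by
    intro p
    simp only [weight, ← Finset.prod_mul_distrib]
    refine Finset.prod_congr rfl fun i _ => ?_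
    by_cases hi : i ∈ T <;> simp [hi, mul_comm]
  calc ∑ y, weight q y • ∑ z, weight q z • f (T.piecewise y z)
      = ∑ p : (∀ i, X i) × (∀ i, X i), (weight q p.1 * weight q p.2) • f (T.piecewise p.1 p.2) := by
        rw [Fintype.sum_prod_type]
        simp only [Finset.smul_sum, smul_smul]
    _ = ∑ p : (∀ i, X i) × (∀ i, X i), (weight q p.1 * weight q p.2) • f p.1 := by
        refine Eq.trans ?_ (Equiv.sum_comp hinv.toPerm
          (fun p => (weight q p.1 * weight q p.2) • f p.1))
        refine Finset.sum_congr rfl fun p _ => ?_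
        simp only [Function.Involutive.coe_toPerm, hw]
    _ = ∑ y, weight q y • f y := by
        rw [Fintype.sum_prod_type]
        refine Finset.sum_congr rfl fun y _ => ?_
        dsimp only
        rw [← Finset.sum_smul, ← Finset.mul_sum, sum_weight hq, mul_one]

lemma average_univ (hq : ∀ i, ∑ a, q i a = 1) (f : (∀ i, X i) → E) (x : ∀ i, X i) :
    average q Finset.univ f x = f x := by
  simp [average, ← Finset.sum_smul, sum_weight hq]

lemma average_empty (f : (∀ i, X i) → E) (x : ∀ i, X i) :
    average q ∅ f x = ∑ z, weight q z • f z := by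
  simp [average]

lemma average_average (hq : ∀ i, ∑ a, q i a = 1) {T S : Finset ι} (hTS : T ⊆ S)
    (f : (∀ i, X i) → E) (x : ∀ i, X i) :
    average q T (average q S f) x = average q T f x := by
  have h : ∀ z z', S.piecewise (T.piecewise x z) z' = T.piecewise x (S.piecewise z z') := by
    intro z z'
    ext i
    by_cases hT : i ∈ T
    · simp [hT, hTS hT]
    · by_cases hS : i ∈ S <;> simp [hT, hS]
  simp only [average, h]
  exact sum_sum_weight_piecewise hq S (fun z => f (T.piecewise x z))

lemma average_sub (T : Finset ι) (f g : (∀ i, X i) → E) (x : ∀ i, X i) :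
    average q T (f - g) x = average q T f x - average q T g x := by
  simp [average, smul_sub]

lemma hoeffding_sub (S : Finset ι) (f g : (∀ i, X i) → E) (x : ∀ i, X i) :
    hoeffding q S (f - g) x = hoeffding q S f x - hoeffding q S g x := by
  simp [hoeffding, average_sub, smul_sub]

/-- Only averages over `T ⊆ S` enter, so the tower property applies. This is why the condition for
`S` need involve only the reduced state on `X_S M`. -/
lemma hoeffding_average (hq : ∀ i, ∑ a, q i a = 1) (S : Finset ι)
    (f : (∀ i, X i) → E) (x : ∀ i, X i) :
    hoeffding q S (average q S f) x = hoeffding q S f x := by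
  refine Finset.sum_congr rfl fun T hT => ?_
  rw [average_average hq (Finset.mem_powerset.1 hT)]

lemma hoeffding_empty (f : (∀ i, X i) → E) (x : ∀ i, X i) :
    hoeffding q ∅ f x = ∑ z, weight q z • f z := by
  simp [hoeffding, average_empty]

lemma map_hoeffding {E' : Type*} [AddCommGroup E'] [Module ℝ E'] (L : E →ₗ[ℝ] E') (S : Finset ι)
    (f : (∀ i, X i) → E) (x : ∀ i, X i) :
    L (hoeffding q S f x) = hoeffding q S (fun y => L (f y)) x := by
  simp [hoeffding, average]

lemma sum_superset_neg_one_pow (T : Finset ι) :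
    ∑ S with T ⊆ S, (-1 : ℝ) ^ (S \ T).card = if T = Finset.univ then 1 else 0 := by
  have h1 : ∑ S with T ⊆ S, (-1 : ℝ) ^ (S \ T).card = ∑ U ∈ Tᶜ.powerset, (-1 : ℝ) ^ U.card := by
    refine Finset.sum_bij' (fun S _ => S \ T) (fun U _ => U ∪ T) ?_ ?_ ?_ ?_ ?_
    · intro S _
      rw [Finset.mem_powerset]
      intro i hi
      simp_all
    · simp
    · intro S hS
      simpa using hS
    · intro U hU
      ext i
      have := fun h : i ∈ U => (Finset.mem_powerset.1 hU) h
      simp only [Finset.mem_compl] at this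
      simp only [Finset.mem_sdiff, Finset.mem_union]
      tauto
    · simp
  rw [h1]
  have h2 := congrArg (Int.cast : ℤ → ℝ) (Finset.sum_powerset_neg_one_pow_card (x := Tᶜ))
  push_cast at h2
  rw [h2]
  simp [Finset.compl_eq_empty_iff]

/-- Möbius inversion on the subset lattice: after exchanging the sums, the coefficient of the
average over `T` vanishes unless `T` is everything. -/
lemma sum_hoeffding (hq : ∀ i, ∑ a, q i a = 1) (f : (∀ i, X i) → E) (x : ∀ i, X i) :
    ∑ S, hoeffding q S f x = f x := by
  simp only [hoeffding]
  rw [Finset.sum_comm' (t' := Finset.univ) (s' := fun T => Finset.univ.filter (T ⊆ ·))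
    (by simp)]
  simp only [← Finset.sum_smul, sum_superset_neg_one_pow, ite_smul, one_smul, zero_smul]
  simp [average_univ hq]

lemma sum_average_insert_update (hq : ∀ i, ∑ a, q i a = 1) {T : Finset ι} {i : ι} (hi : i ∉ T)
    (f : (∀ i, X i) → E) (x : ∀ i, X i) :
    ∑ a, q i a • average q (insert i T) f (Function.update x i a) = average q T f x := by
  have h : ∀ a z, (insert i T).piecewise (Function.update x i a) z
      = T.piecewise x (Function.update z i a) := by
    intro a z
    ext j
    by_cases hj : j = i
    · subst hj; simp [hi]
    · by_cases hT : j ∈ T <;> simp [hT, hj]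
  rw [average, ← sum_weight_update hq i]
  simp only [average, h, Finset.smul_sum]
  rw [Finset.sum_comm]
  exact Finset.sum_congr rfl fun z _ => Finset.sum_congr rfl fun a _ => smul_comm _ _ _

lemma average_update {T : Finset ι} {i : ι} (hi : i ∉ T)
    (f : (∀ i, X i) → E) (x : ∀ i, X i) (a : X i) :
    average q T f (Function.update x i a) = average q T f x := by
  refine Finset.sum_congr rfl fun z _ => ?_
  congr 2
  ext j
  by_cases hj : j = i
  · subst hj; simp [hi]
  · by_cases hT : j ∈ T <;> simp [hT, hj]

/-- Pair each `T` not containing `i` with `insert i T`: after averaging over coordinate `i` the two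
terms coincide and carry opposite signs. -/
lemma sum_hoeffding_update (hq : ∀ i, ∑ a, q i a = 1) {S : Finset ι} {i : ι} (hi : i ∈ S)
    (f : (∀ i, X i) → E) (x : ∀ i, X i) :
    ∑ a, q i a • hoeffding q S f (Function.update x i a) = 0 := by
  obtain ⟨S', hS', rfl⟩ : ∃ S', i ∉ S' ∧ insert i S' = S :=
    ⟨S.erase i, Finset.notMem_erase i S, Finset.insert_erase hi⟩
  simp only [hoeffding, Finset.smul_sum]
  rw [Finset.sum_comm, Finset.sum_powerset_insert hS', ← Finset.sum_add_distrib]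
  refine Finset.sum_eq_zero fun T hT => ?_
  have hT' := Finset.mem_powerset.1 hT
  have hiT : i ∉ T := fun h => hS' (hT' h)
  have hc : ∀ (a : X i) (r : ℝ) (v : E), q i a • r • v = r • q i a • v := fun a r v =>
    smul_comm _ _ _
  simp only [hc]
  rw [← Finset.smul_sum, ← Finset.smul_sum, sum_average_insert_update hq hiT]
  simp only [average_update hiT]
  rw [← Finset.sum_smul, hq, one_smul]
  have h1 : (insert i S' \ T).card = (S' \ T).card + 1 := by
    rw [Finset.insert_sdiff_of_notMem _ hiT, Finset.card_insert_of_notMem (by simp [hS'])]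
  have h2 : insert i S' \ insert i T = S' \ T := by
    ext j
    simp only [Finset.mem_sdiff, Finset.mem_insert]
    by_cases hj : j = i
    · subst hj; simp [hS']
    · simp [hj]
  rw [h1, h2, pow_succ]
  simp

lemma sum_weight_seminorm_average_le (hq0 : ∀ i a, 0 ≤ q i a) (hq : ∀ i, ∑ a, q i a = 1)
    (N : Seminorm ℝ E) (T : Finset ι) (f : (∀ i, X i) → E) :
    ∑ y, weight q y * N (average q T f y) ≤ ∑ y, weight q y * N (f y) := by
  refine le_trans ?_ (sum_sum_weight_piecewise hq T (fun y => N (f y))).le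
  refine Finset.sum_le_sum fun y _ => mul_le_mul_of_nonneg_left ?_ (weight_nonneg hq0 y)
  refine (Finset.le_sum_of_subadditive N (map_zero N).le (map_add_le_add N) _ _).trans_eq ?_
  refine Finset.sum_congr rfl fun z _ => ?_
  rw [map_smul_eq_mul, Real.norm_of_nonneg (weight_nonneg hq0 z), smul_eq_mul]

lemma sum_weight_seminorm_hoeffding_le (hq0 : ∀ i a, 0 ≤ q i a) (hq : ∀ i, ∑ a, q i a = 1)
    (N : Seminorm ℝ E) (S : Finset ι) (f : (∀ i, X i) → E) :
    ∑ y, weight q y * N (hoeffding q S f y) ≤ 2 ^ S.card * ∑ y, weight q y * N (f y) := by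
  calc ∑ y, weight q y * N (hoeffding q S f y)
      ≤ ∑ y, weight q y * ∑ T ∈ S.powerset, N (average q T f y) := by
        refine Finset.sum_le_sum fun y _ => mul_le_mul_of_nonneg_left ?_ (weight_nonneg hq0 y)
        refine (Finset.le_sum_of_subadditive N (map_zero N).le (map_add_le_add N) _ _).trans_eq ?_
        simp [map_smul_eq_mul]
    _ = ∑ T ∈ S.powerset, ∑ y, weight q y * N (average q T f y) := by
        simp only [Finset.mul_sum]
        exact Finset.sum_comm
    _ ≤ ∑ T ∈ S.powerset, ∑ y, weight q y * N (f y) :=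
        Finset.sum_le_sum fun T _ => sum_weight_seminorm_average_le hq0 hq N T f
    _ = _ := by simp

lemma sum_weight_norm_sq_average_le (hq0 : ∀ i a, 0 ≤ q i a) (hq : ∀ i, ∑ a, q i a = 1)
    (T : Finset ι) (h : (∀ i, X i) → ℂ) :
    ∑ y, weight q y * ‖average q T h y‖ ^ 2 ≤ ∑ y, weight q y * ‖h y‖ ^ 2 := by
  refine le_trans ?_ (sum_sum_weight_piecewise hq T (fun y => ‖h y‖ ^ 2)).le
  refine Finset.sum_le_sum fun y _ => mul_le_mul_of_nonneg_left ?_ (weight_nonneg hq0 y)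
  have h1 : ‖average q T h y‖ ≤ ∑ z, weight q z * ‖h (T.piecewise y z)‖ := by
    refine (norm_sum_le _ _).trans_eq ?_
    refine Finset.sum_congr rfl fun z _ => ?_
    rw [norm_smul, Real.norm_of_nonneg (weight_nonneg hq0 z)]
  refine (pow_le_pow_left₀ (norm_nonneg _) h1 2).trans ?_
  exact Real.pow_arith_mean_le_arith_mean_pow _ _ _ (fun z _ => weight_nonneg hq0 z)
    (sum_weight hq) (fun z _ => norm_nonneg _) 2

/-- Cauchy–Schwarz over the `2^|S|` summands gives one factor `2^|S|`, and their number gives the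
other. Its square root matches the constant of the seminorm bound. -/
lemma sum_weight_norm_sq_hoeffding_le (hq0 : ∀ i a, 0 ≤ q i a) (hq : ∀ i, ∑ a, q i a = 1)
    (S : Finset ι) (h : (∀ i, X i) → ℂ) :
    ∑ y, weight q y * ‖hoeffding q S h y‖ ^ 2 ≤ 4 ^ S.card * ∑ y, weight q y * ‖h y‖ ^ 2 := by
  calc ∑ y, weight q y * ‖hoeffding q S h y‖ ^ 2
      ≤ ∑ y, weight q y * (2 ^ S.card * ∑ T ∈ S.powerset, ‖average q T h y‖ ^ 2) := by
        refine Finset.sum_le_sum fun y _ => mul_le_mul_of_nonneg_left ?_ (weight_nonneg hq0 y)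
        have h1 : ‖hoeffding q S h y‖ ≤ ∑ T ∈ S.powerset, ‖average q T h y‖ := by
          refine (norm_sum_le _ _).trans_eq ?_
          simp
        refine (pow_le_pow_left₀ (norm_nonneg _) h1 2).trans ?_
        refine (sq_sum_le_card_mul_sum_sq).trans_eq ?_
        simp
    _ = 2 ^ S.card * ∑ T ∈ S.powerset, ∑ y, weight q y * ‖average q T h y‖ ^ 2 := by
        rw [Finset.sum_comm, Finset.mul_sum]
        simp only [Finset.mul_sum]
        refine Finset.sum_congr rfl fun y _ => Finset.sum_congr rfl fun T _ => ?_
        ring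
    _ ≤ 2 ^ S.card * ∑ T ∈ S.powerset, ∑ y, weight q y * ‖h y‖ ^ 2 := by
        refine mul_le_mul_of_nonneg_left (Finset.sum_le_sum fun T _ => ?_) (by positivity)
        exact sum_weight_norm_sq_average_le hq0 hq T h
    _ = _ := by
        rw [Finset.sum_const, Finset.card_powerset, nsmul_eq_mul, ← mul_assoc]
        push_cast
        rw [← mul_pow]
        norm_num

end Product

/-- Push-forward of a product law under a coordinatewise map is the product of the push-forwards. -/
lemma sum_weight_comp {ι : Type*} [Fintype ι] [DecidableEq ι] {X Y : ι → Type*}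
    [∀ i, Fintype (X i)] [∀ i, DecidableEq (X i)] [∀ i, Fintype (Y i)]
    {q : ∀ i, X i → ℝ} {W : ∀ i, Y i → ℝ} (π : ∀ i, Y i → X i)
    (hπ : ∀ i a, ∑ u with π i u = a, W i u = q i a) (φ : (∀ i, X i) → ℝ) :
    ∑ x, weight W x * φ (fun i => π i (x i)) = ∑ y, weight q y * φ y := by
  rw [← Finset.sum_fiberwise Finset.univ (fun x i => π i (x i))]
  refine Finset.sum_congr rfl fun y _ => ?_
  have h1 : weight q y = ∑ x with (fun i => π i (x i)) = y, weight W x := by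
    simp only [weight, ← hπ]
    rw [Finset.prod_univ_sum]
    refine Finset.sum_congr ?_ fun _ _ => rfl
    ext x
    simp [Fintype.mem_piFinset, funext_iff]
  rw [h1, Finset.sum_mul]
  refine Finset.sum_congr rfl fun x hx => ?_
  rw [(Finset.mem_filter.1 hx).2]

/-! ### Moments of averages over independent samples. -/

section Sampling

variable {k : ℕ} {X : Fin k → Type*} [∀ i, Fintype (X i)] [∀ i, DecidableEq (X i)]
variable {q : ∀ i, X i → ℝ} {A : Fin k → ℕ}

lemma expectIID_mono (hq0 : ∀ i a, 0 ≤ q i a) {f g : (∀ i, Fin (A i) → X i) → ℝ}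
    (h : ∀ x, f x ≤ g x) : expectIID q A f ≤ expectIID q A g :=
  Finset.sum_le_sum fun x _ => mul_le_mul_of_nonneg_left (h x)
    (Finset.prod_nonneg fun i _ => Finset.prod_nonneg fun _ _ => hq0 i _)

lemma expectIID_sum {κ : Type*} (s : Finset κ) (f : κ → (∀ i, Fin (A i) → X i) → ℝ) :
    expectIID q A (fun x => ∑ c ∈ s, f c x) = ∑ c ∈ s, expectIID q A (f c) := by
  simp only [expectIID, Finset.mul_sum]
  exact Finset.sum_comm

lemma expectIID_const_mul (c : ℝ) (f : (∀ i, Fin (A i) → X i) → ℝ) :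
    expectIID q A (fun x => c * f x) = c * expectIID q A f := by
  simp only [expectIID, Finset.mul_sum]
  exact Finset.sum_congr rfl fun _ _ => by ring

lemma expectIID_eq (f : (∀ i, Fin (A i) → X i) → ℝ) :
    expectIID q A f = ∑ x, weight (fun i => weight fun _ : Fin (A i) => q i) x * f x := rfl

lemma expectIID_update (hq : ∀ i, ∑ a, q i a = 1) (i : Fin k) (j : Fin (A i))
    (f : (∀ i, Fin (A i) → X i) → ℝ) :
    expectIID q A (fun x => ∑ b, q i b * f (Function.update x i (Function.update (x i) j b)))
      = expectIID q A f := by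
  have hW : ∀ i, ∑ u, weight (fun _ : Fin (A i) => q i) u = 1 := fun i => sum_weight fun _ => hq i
  have h1 := sum_weight_update hW i f
  have h2 := sum_weight_update hW i
    (fun x => ∑ b, q i b * f (Function.update x i (Function.update (x i) j b)))
  simp only [smul_eq_mul] at h1 h2
  rw [expectIID_eq, expectIID_eq, ← h1, ← h2]
  refine Finset.sum_congr rfl fun x _ => ?_
  congr 1
  have h3 := sum_weight_update (q := fun _ : Fin (A i) => q i) (fun _ => hq i) j
    (fun u => f (Function.update x i u))
  simp only [smul_eq_mul] at h3
  rw [← h3]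
  simp

lemma sum_weight_const_filter (hq : ∀ i, ∑ a, q i a = 1) (i : Fin k) (j : Fin (A i)) (a : X i) :
    ∑ u : Fin (A i) → X i with u j = a, weight (fun _ => q i) u = q i a := by
  have h := sum_weight_update (q := fun _ : Fin (A i) => q i) (fun _ => hq i) j
    (fun u => if u j = a then (1 : ℝ) else 0)
  simp only [smul_eq_mul, Function.update_self, mul_ite, mul_one, mul_zero, Finset.sum_ite_eq',
    Finset.mem_univ, if_true] at h
  rw [Finset.sum_filter, ← h, ← Finset.sum_mul, sum_weight (fun _ => hq i), one_mul]

/-- For a fixed index tuple `a`, the chosen entries come from different registers, so they are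
independent with law `∏ q i`. -/
lemma expectIID_comp (hq : ∀ i, ∑ a, q i a = 1) (a : ∀ i, Fin (A i)) (φ : (∀ i, X i) → ℝ) :
    expectIID q A (fun x => φ (fun i => x i (a i))) = ∑ y, weight q y * φ y :=
  sum_weight_comp (fun i (u : Fin (A i) → X i) => u (a i))
    (fun i b => sum_weight_const_filter hq i (a i) b) φ

lemma expectIID_seminorm_average_le {E : Type*} [AddCommGroup E] [Module ℝ E]
    (hq0 : ∀ i a, 0 ≤ q i a) (hq : ∀ i, ∑ a, q i a = 1) (hA : ∀ i, 0 < A i)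
    (N : Seminorm ℝ E) (h : (∀ i, X i) → E) :
    expectIID q A (fun x => N ((∏ i, (A i : ℝ))⁻¹ • ∑ a : ∀ i, Fin (A i), h (fun i => x i (a i))))
      ≤ ∑ y, weight q y * N (h y) := by
  have hpos : 0 < ∏ i, (A i : ℝ) := Finset.prod_pos fun i _ => Nat.cast_pos.2 (hA i)
  calc _ ≤ expectIID q A (fun x => (∏ i, (A i : ℝ))⁻¹ *
          ∑ a : ∀ i, Fin (A i), N (h (fun i => x i (a i)))) := by
        refine expectIID_mono hq0 fun x => ?_
        rw [map_smul_eq_mul, Real.norm_of_nonneg (inv_nonneg.2 hpos.le)]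
        exact mul_le_mul_of_nonneg_left
          (Finset.le_sum_of_subadditive N (map_zero N).le (map_add_le_add N) _ _)
          (inv_nonneg.2 hpos.le)
    _ = ∑ y, weight q y * N (h y) := by
        rw [expectIID_const_mul, expectIID_sum]
        simp only [expectIID_comp hq _ (fun y => N (h y))]
        rw [Finset.sum_const, nsmul_eq_mul, Finset.card_univ, Fintype.card_pi]
        simp only [Fintype.card_fin]
        push_cast
        rw [inv_mul_cancel_left₀ hpos.ne']

/-- Resample the single entry `x i (a i)`. The second factor reads `x i (b i)` instead and is
unaffected, while the first averages to zero. -/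
lemma expectIID_inner_eq_zero (hq : ∀ i, ∑ a, q i a = 1) {h : (∀ i, X i) → ℂ} {i : Fin k}
    (hzero : ∀ y, ∑ b, q i b • h (Function.update y i b) = 0) {a b : ∀ i, Fin (A i)}
    (hab : a i ≠ b i) :
    expectIID q A (fun x => inner ℝ (h fun i => x i (a i)) (h fun i => x i (b i))) = 0 := by
  rw [← expectIID_update hq i (a i)]
  rw [show (0 : ℝ) = expectIID q A (fun _ => 0) by simp [expectIID]]
  congr 1
  ext x
  have h1 : ∀ c, (fun i' => (Function.update x i (Function.update (x i) (a i) c)) i' (a i'))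
      = Function.update (fun i => x i (a i)) i c := by
    intro c
    ext i'
    by_cases hi : i' = i
    · subst hi; simp
    · simp [hi]
  have h2 : ∀ c, (fun i' => (Function.update x i (Function.update (x i) (a i) c)) i' (b i'))
      = fun i => x i (b i) := by
    intro c
    ext i'
    by_cases hi : i' = i
    · subst hi; simp [hab.symm]
    · simp [hi]
  simp only [h1, h2, ← real_inner_smul_left]
  rw [← sum_inner, hzero, inner_zero_left]

lemma expectIID_inner_le (hq0 : ∀ i a, 0 ≤ q i a) (hq : ∀ i, ∑ a, q i a = 1)
    (h : (∀ i, X i) → ℂ) (a b : ∀ i, Fin (A i)) :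
    expectIID q A (fun x => inner ℝ (h fun i => x i (a i)) (h fun i => x i (b i)))
      ≤ ∑ y, weight q y * ‖h y‖ ^ 2 := by
  have h1 := expectIID_comp hq a (fun y => ‖h y‖ ^ 2)
  have h2 := expectIID_comp hq b (fun y => ‖h y‖ ^ 2)
  -- The bound is `⟨u, v⟩ ≤ ‖u‖²/2 + ‖v‖²/2`; each singleton sum only carries the factor `1/2`.
  calc _ ≤ expectIID q A (fun x => ∑ c ∈ {(1 / 2 : ℝ)}, c * ‖h fun i => x i (a i)‖ ^ 2) +
          expectIID q A (fun x => ∑ c ∈ {(1 / 2 : ℝ)}, c * ‖h fun i => x i (b i)‖ ^ 2) := by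
        simp only [expectIID, ← Finset.sum_add_distrib, ← mul_add]
        refine expectIID_mono hq0 fun x => ?_
        have := real_inner_le_norm (h fun i => x i (a i)) (h fun i => x i (b i))
        simp only [Finset.sum_singleton]
        nlinarith [sq_nonneg (‖h fun i => x i (a i)‖ - ‖h fun i => x i (b i)‖)]
    _ = _ := by
        simp only [Finset.sum_singleton, expectIID_const_mul, h1, h2]
        ring

lemma card_agree (S : Finset (Fin k)) (a : ∀ i, Fin (A i)) :
    ((Finset.univ.filter fun b : ∀ i, Fin (A i) => ∀ i ∈ S, a i = b i).card : ℝ)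
      = ∏ i ∈ Sᶜ, (A i : ℝ) := by
  have h1 : (Finset.univ.filter fun b : ∀ i, Fin (A i) => ∀ i ∈ S, a i = b i)
      = Fintype.piFinset fun i => if i ∈ S then {a i} else Finset.univ := by
    ext b
    simp only [Finset.mem_filter, Finset.mem_univ, true_and, Fintype.mem_piFinset]
    refine forall_congr' fun i => ?_
    by_cases hi : i ∈ S <;> simp [hi, eq_comm]
  rw [h1, Fintype.card_piFinset]
  push_cast
  rw [← Finset.prod_mul_prod_compl S]
  rw [Finset.prod_eq_one (s := S) fun i hi => by simp [hi], one_mul]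
  refine Finset.prod_congr rfl fun i hi => ?_
  simp [Finset.mem_compl.1 hi]

/-- Expand the square. Only pairs `a`, `b` agreeing on `S` contribute: there are `∏ A_i` choices of
`a` and `∏_{i ∉ S} A_i` of `b`, against `(∏ A_i)²` in the normalisation. -/
lemma expectIID_norm_sq_average_le (hq0 : ∀ i a, 0 ≤ q i a) (hq : ∀ i, ∑ a, q i a = 1)
    (hA : ∀ i, 0 < A i) (S : Finset (Fin k)) (h : (∀ i, X i) → ℂ)
    (hzero : ∀ i ∈ S, ∀ y, ∑ b, q i b • h (Function.update y i b) = 0) :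
    expectIID q A
        (fun x => ‖(∏ i, (A i : ℝ))⁻¹ • ∑ a : ∀ i, Fin (A i), h (fun i => x i (a i))‖ ^ 2)
      ≤ (∏ i ∈ S, (A i : ℝ))⁻¹ * ∑ y, weight q y * ‖h y‖ ^ 2 := by
  have hpos : 0 < ∏ i, (A i : ℝ) := Finset.prod_pos fun i _ => Nat.cast_pos.2 (hA i)
  have hposS : 0 < ∏ i ∈ S, (A i : ℝ) := Finset.prod_pos fun i _ => Nat.cast_pos.2 (hA i)
  have hposC : 0 < ∏ i ∈ Sᶜ, (A i : ℝ) := Finset.prod_pos fun i _ => Nat.cast_pos.2 (hA i)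
  have hprod := Finset.prod_mul_prod_compl S fun i => (A i : ℝ)
  set V := ∑ y, weight q y * ‖h y‖ ^ 2 with hV
  have key : ∀ a b : ∀ i, Fin (A i),
      expectIID q A (fun x => inner ℝ (h fun i => x i (a i)) (h fun i => x i (b i)))
        ≤ if ∀ i ∈ S, a i = b i then V else 0 := by
    intro a b
    split_ifs with hab
    · exact expectIID_inner_le hq0 hq h a b
    · push Not at hab
      obtain ⟨i, hi, hne⟩ := hab
      exact (expectIID_inner_eq_zero hq (hzero i hi) hne).le
  calc _ = (∏ i, (A i : ℝ))⁻¹ ^ 2 * ∑ a : ∀ i, Fin (A i), ∑ b : ∀ i, Fin (A i),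
          expectIID q A (fun x => inner ℝ (h fun i => x i (a i)) (h fun i => x i (b i))) := by
        simp only [← expectIID_sum]
        rw [← expectIID_const_mul]
        congr 1
        ext x
        rw [norm_smul, mul_pow, Real.norm_of_nonneg (inv_nonneg.2 hpos.le),
          ← real_inner_self_eq_norm_sq, sum_inner]
        simp only [inner_sum]
    _ ≤ (∏ i, (A i : ℝ))⁻¹ ^ 2 * ∑ a : ∀ i, Fin (A i), ∑ b : ∀ i, Fin (A i),
          if ∀ i ∈ S, a i = b i then V else 0 :=
        mul_le_mul_of_nonneg_left
          (Finset.sum_le_sum fun a _ => Finset.sum_le_sum fun b _ => key a b) (by positivity)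
    _ = (∏ i, (A i : ℝ))⁻¹ ^ 2 * ((∏ i, (A i : ℝ)) * ((∏ i ∈ Sᶜ, (A i : ℝ)) * V)) := by
        simp only [← Finset.sum_filter, Finset.sum_const, nsmul_eq_mul, card_agree]
        rw [Finset.card_univ, Fintype.card_pi]
        simp only [Fintype.card_fin]
        push_cast
        rfl
    _ = _ := by
        rw [← hprod]
        field_simp

lemma expectIID_le_sqrt (hq0 : ∀ i a, 0 ≤ q i a) (hq : ∀ i, ∑ a, q i a = 1)
    {f : (∀ i, Fin (A i) → X i) → ℝ} (hf : ∀ x, 0 ≤ f x) :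
    expectIID q A f ≤ Real.sqrt (expectIID q A fun x => f x ^ 2) := by
  have hW : ∀ i, ∑ u, weight (fun _ : Fin (A i) => q i) u = 1 := fun i => sum_weight fun _ => hq i
  refine Real.le_sqrt_of_sq_le ?_
  exact Real.pow_arith_mean_le_arith_mean_pow _ _ _
    (fun x _ => weight_nonneg (fun i u => weight_nonneg (fun _ => hq0 i) u) x)
    (sum_weight hW) (fun x _ => hf x) 2

end Sampling

/-! ### Schatten norms and the variational trace norm. -/

section MatrixNorms

open Matrix

variable {n : Type*} [Fintype n] [DecidableEq n]

lemma schattenTwo_sq (A : Matrix n n ℂ) : schattenTwo A ^ 2 = ∑ i, ∑ j, ‖A i j‖ ^ 2 := by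
  have h : (Aᴴ * A).trace.re = ∑ i, ∑ j, ‖A i j‖ ^ 2 := by
    rw [Finset.sum_comm]
    simp only [Matrix.trace, Matrix.diag_apply, Matrix.mul_apply, Complex.re_sum,
      Matrix.conjTranspose_apply]
    refine Finset.sum_congr rfl fun i _ => Finset.sum_congr rfl fun j _ => ?_
    rw [← Complex.normSq_eq_norm_sq, RCLike.star_def, Complex.normSq_eq_conj_mul_self.symm,
      Complex.ofReal_re]
  rw [schattenTwo, h, Real.sq_sqrt]
  positivity

lemma schattenTwo_nonneg (A : Matrix n n ℂ) : 0 ≤ schattenTwo A := Real.sqrt_nonneg _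

lemma abs_re_trace_mul_le (C B : Matrix n n ℂ) :
    |(C * B).trace.re| ≤ schattenTwo C * schattenTwo B := by
  have h1 : |(C * B).trace.re| ≤ ∑ p : n × n, ‖C p.1 p.2‖ * ‖B p.2 p.1‖ := by
    refine (Complex.abs_re_le_norm _).trans ?_
    rw [Fintype.sum_prod_type]
    simp only [Matrix.trace, Matrix.diag_apply, Matrix.mul_apply]
    refine (norm_sum_le _ _).trans (Finset.sum_le_sum fun i _ => (norm_sum_le _ _).trans_eq ?_)
    simp only [norm_mul]
  refine h1.trans ((Real.sum_mul_le_sqrt_mul_sqrt _ _ _).trans_eq ?_)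
  congr 1
  · rw [Fintype.sum_prod_type]
    dsimp only
    rw [← schattenTwo_sq, Real.sqrt_sq (schattenTwo_nonneg C)]
  · rw [Fintype.sum_prod_type_right]
    dsimp only
    rw [← schattenTwo_sq, Real.sqrt_sq (schattenTwo_nonneg B)]

lemma bddAbove_abs_re_trace_unitary_mul (A : Matrix n n ℂ) :
    BddAbove (Set.range fun U : unitaryGroup n ℂ => |((U : Matrix n n ℂ) * A).trace.re|) := by
  refine ⟨∑ i, ∑ j, ‖A j i‖, ?_⟩
  rintro _ ⟨U, rfl⟩
  refine (Complex.abs_re_le_norm _).trans ?_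
  simp only [Matrix.trace, Matrix.diag_apply, Matrix.mul_apply]
  refine (norm_sum_le _ _).trans (Finset.sum_le_sum fun i _ => (norm_sum_le _ _).trans
    (Finset.sum_le_sum fun j _ => ?_))
  rw [norm_mul]
  exact mul_le_of_le_one_left (norm_nonneg _) (entry_norm_bound_of_unitary U.2 i j)

/-- The trace norm in its variational form `sup_U |Re Tr (U A)|` over unitaries `U`. -/
def traceSeminorm (n : Type*) [Fintype n] [DecidableEq n] : Seminorm ℝ (Matrix n n ℂ) :=
  Seminorm.of (fun A => ⨆ U : unitaryGroup n ℂ, |((U : Matrix n n ℂ) * A).trace.re|)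
    (fun A B => ciSup_le fun U => by
      rw [mul_add, trace_add, Complex.add_re]
      exact (abs_add_le _ _).trans (add_le_add
        (le_ciSup (bddAbove_abs_re_trace_unitary_mul A) U)
        (le_ciSup (bddAbove_abs_re_trace_unitary_mul B) U)))
    (fun c A => by
      simp only [Matrix.mul_smul, trace_smul, Complex.smul_re, smul_eq_mul, abs_mul,
        Real.norm_eq_abs]
      exact (Real.mul_iSup_of_nonneg (abs_nonneg c) _).symm)

lemma abs_re_trace_unitary_mul_le {U : Matrix n n ℂ} (hU : U ∈ unitaryGroup n ℂ)
    (A : Matrix n n ℂ) : |(U * A).trace.re| ≤ traceSeminorm n A :=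
  le_ciSup (bddAbove_abs_re_trace_unitary_mul A) ⟨U, hU⟩

lemma traceSeminorm_le {A : Matrix n n ℂ} {c : ℝ}
    (h : ∀ U ∈ unitaryGroup n ℂ, |(U * A).trace.re| ≤ c) : traceSeminorm n A ≤ c :=
  ciSup_le fun U => h U U.2

lemma cfc_eq_of_diagonalization {V : Matrix n n ℂ} (hV : V ∈ unitaryGroup n ℂ) (e : n → ℝ)
    (f : ℝ → ℝ) :
    cfc f (V * diagonal (fun i => (e i : ℂ)) * Vᴴ)
      = V * diagonal (fun i => (f (e i) : ℂ)) * Vᴴ := by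
  have hV1 : Vᴴ * V = 1 := mem_unitaryGroup_iff'.1 hV
  have hV2 : V * Vᴴ = 1 := mem_unitaryGroup_iff.1 hV
  set M := V * diagonal (fun i => (e i : ℂ)) * Vᴴ with hM
  have hsa : IsSelfAdjoint M := by
    rw [IsSelfAdjoint, star_eq_conjTranspose, hM, conjTranspose_mul, conjTranspose_mul,
      conjTranspose_conjTranspose, diagonal_conjTranspose, mul_assoc]
    congr 3
    ext i
    simp
  have hpow : ∀ r : ℕ, M ^ r = V * diagonal (fun i => ((e i ^ r : ℝ) : ℂ)) * Vᴴ := by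
    intro r
    induction r with
    | zero => simp [hV2]
    | succ r ih =>
      rw [pow_succ, ih, hM]
      calc _ = V * diagonal (fun i => ((e i ^ r : ℝ) : ℂ)) * (Vᴴ * V)
            * diagonal (fun i => (e i : ℂ)) * Vᴴ := by simp only [mul_assoc]
        _ = _ := by
          rw [hV1, mul_one, mul_assoc V, diagonal_mul_diagonal]
          congr 3
          ext i
          push_cast
          ring
  have hpoly : ∀ P : Polynomial ℝ, Polynomial.aeval M P
      = V * diagonal (fun i => ((P.eval (e i) : ℝ) : ℂ)) * Vᴴ := by
    intro P
    induction P using Polynomial.induction_on' with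
    | add P Q hP hQ =>
      rw [map_add, hP, hQ, ← add_mul, ← mul_add, diagonal_add]
      simp
    | monomial r c =>
      rw [Polynomial.aeval_monomial, hpow, ← Algebra.smul_def]
      rw [← Matrix.smul_mul, ← Matrix.mul_smul, ← diagonal_smul]
      congr 3
      ext i
      simp
  have hspec : spectrum ℝ M ⊆ Set.range e := by
    intro x hx
    have hx' : (x : ℂ) ∈ spectrum ℂ M := (spectrum.algebraMap_mem_iff (R := ℝ) ℂ).2 hx
    rw [hM, show V * diagonal (fun i => (e i : ℂ)) * Vᴴ
      = ((⟨V, hV⟩ : unitary (Matrix n n ℂ)) : Matrix n n ℂ) * diagonal (fun i => (e i : ℂ))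
        * star ((⟨V, hV⟩ : unitary (Matrix n n ℂ)) : Matrix n n ℂ) from rfl,
      Unitary.spectrum_star_right_conjugate, spectrum_diagonal] at hx'
    obtain ⟨i, hi⟩ := hx'
    exact ⟨i, Complex.ofReal_injective hi⟩
  -- The functional calculus sees `f` only on the finite spectrum, so a polynomial interpolating `f`
  -- at the eigenvalues can replace it.
  let P := Lagrange.interpolate (Finset.univ.image e) id f
  have hP : ∀ i, P.eval (e i) = f (e i) := fun i =>
    Lagrange.eval_interpolate_at_node f (v := id) (Set.injOn_id _)
      (Finset.mem_image_of_mem e (Finset.mem_univ i))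
  calc cfc f M = cfc P.eval M := by
        refine cfc_congr fun x hx => ?_
        obtain ⟨i, rfl⟩ := hspec hx
        exact (hP i).symm
    _ = _ := by
        rw [cfc_polynomial P M hsa, hpoly]
        simp only [hP]

lemma exists_diagonalization {A : Matrix n n ℂ} (hA : A.IsHermitian) :
    ∃ V ∈ unitaryGroup n ℂ,
      A = V * diagonal (fun i => (hA.eigenvalues i : ℂ)) * Vᴴ := by
  refine ⟨hA.eigenvectorUnitary, hA.eigenvectorUnitary.2, ?_⟩
  conv_lhs => rw [hA.spectral_theorem]
  rfl

lemma trace_unitary_conj {V : Matrix n n ℂ} (hV : V ∈ unitaryGroup n ℂ) (M : Matrix n n ℂ) :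
    (V * M * Vᴴ).trace = M.trace := by
  rw [trace_mul_comm, ← mul_assoc, show Vᴴ * V = 1 from mem_unitaryGroup_iff'.1 hV, one_mul]

lemma schattenOne_diagonalization {V : Matrix n n ℂ} (hV : V ∈ unitaryGroup n ℂ) (e : n → ℝ) :
    schattenOne (V * diagonal (fun i => (e i : ℂ)) * Vᴴ) = ∑ i, |e i| := by
  have hV1 : Vᴴ * V = 1 := mem_unitaryGroup_iff'.1 hV
  have h : (V * diagonal (fun i => (e i : ℂ)) * Vᴴ)ᴴ * (V * diagonal (fun i => (e i : ℂ)) * Vᴴ)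
      = V * diagonal (fun i => ((e i ^ 2 : ℝ) : ℂ)) * Vᴴ := by
    rw [conjTranspose_mul, conjTranspose_mul, conjTranspose_conjTranspose, diagonal_conjTranspose]
    calc _ = V * diagonal (star fun i => (e i : ℂ)) * (Vᴴ * V)
            * diagonal (fun i => (e i : ℂ)) * Vᴴ := by simp only [mul_assoc]
      _ = _ := by
        rw [hV1, mul_one, mul_assoc V, diagonal_mul_diagonal]
        congr 3
        ext i
        simp [sq]
  rw [schattenOne, h, cfc_eq_of_diagonalization hV, trace_unitary_conj hV, trace_diagonal]
  simp [Real.sqrt_sq_eq_abs]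

lemma exists_unitary_re_trace_eq {A : Matrix n n ℂ} (hA : A.IsHermitian) :
    ∃ U ∈ unitaryGroup n ℂ, (U * A).trace.re = schattenOne A := by
  obtain ⟨V, hV, hAV⟩ := exists_diagonalization hA
  generalize hA.eigenvalues = e at hAV
  subst hAV
  have hV1 : Vᴴ * V = 1 := mem_unitaryGroup_iff'.1 hV
  have hV2 : V * Vᴴ = 1 := mem_unitaryGroup_iff.1 hV
  -- The sign is set to `1` at zero eigenvalues, so that the sign matrix is unitary.
  let s : n → ℂ := fun i => if 0 ≤ e i then 1 else -1
  have hs : ∀ i, s i * s i = 1 := fun i => by simp only [s]; split_ifs <;> norm_num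
  have hss : star s = s := by ext i; simp only [s, Pi.star_apply]; split_ifs <;> simp
  refine ⟨V * diagonal s * Vᴴ, ?_, ?_⟩
  · rw [mem_unitaryGroup_iff, star_eq_conjTranspose, conjTranspose_mul, conjTranspose_mul,
      conjTranspose_conjTranspose, diagonal_conjTranspose, hss]
    calc _ = V * diagonal s * (Vᴴ * V) * diagonal s * Vᴴ := by simp only [mul_assoc]
      _ = 1 := by
        rw [hV1, mul_one, mul_assoc V, diagonal_mul_diagonal]
        simp [hs, hV2]
  · rw [schattenOne_diagonalization hV]
    calc _ = (V * diagonal s * (Vᴴ * V) * diagonal (fun i => (e i : ℂ)) * Vᴴ).trace.re := by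
          simp only [mul_assoc]
      _ = _ := by
        rw [hV1, mul_one, mul_assoc V, diagonal_mul_diagonal, trace_unitary_conj hV,
          trace_diagonal, Complex.re_sum]
        refine Finset.sum_congr rfl fun i _ => ?_
        simp only [s]
        split_ifs with h
        · simp [abs_of_nonneg h]
        · simp [abs_of_neg (not_le.1 h)]

/-- The sign unitary attains the supremum; conversely, in an eigenbasis the diagonal entries of any
unitary have modulus at most one. This supplies the triangle inequality for `schattenOne` on
Hermitian matrices. -/
lemma schattenOne_eq_traceSeminorm {A : Matrix n n ℂ} (hA : A.IsHermitian) :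
    schattenOne A = traceSeminorm n A := by
  refine le_antisymm ?_ (traceSeminorm_le fun U hU => ?_)
  · obtain ⟨U, hU, h⟩ := exists_unitary_re_trace_eq hA
    exact h ▸ (le_abs_self _).trans (abs_re_trace_unitary_mul_le hU A)
  · obtain ⟨V, hV, hAV⟩ := exists_diagonalization hA
    generalize hA.eigenvalues = e at hAV
    subst hAV
    rw [schattenOne_diagonalization hV]
    have hW : Vᴴ * U * V ∈ unitaryGroup n ℂ :=
      mul_mem (mul_mem (Unitary.star_mem hV) hU) hV
    have h1 : (U * (V * diagonal (fun i => (e i : ℂ)) * Vᴴ)).trace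
        = ∑ i, (Vᴴ * U * V) i i * (e i : ℂ) := by
      rw [← mul_assoc, trace_mul_comm, ← mul_assoc, ← mul_assoc]
      simp [Matrix.trace, mul_diagonal]
    rw [h1]
    refine (Complex.abs_re_le_norm _).trans ((norm_sum_le _ _).trans
      (Finset.sum_le_sum fun i _ => ?_))
    rw [norm_mul, Complex.norm_real, Real.norm_eq_abs]
    exact mul_le_of_le_one_left (abs_nonneg _) (entry_norm_bound_of_unitary hW i i)

end MatrixNorms

/-! ### Fourth roots, pseudoinverses and the weighted 2-norm bound. -/

section Roots

open Matrix

variable {n : Type*} [Fintype n] [DecidableEq n]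

/-- The fourth root of a positive semidefinite matrix. -/
def fourthRoot (β : Matrix n n ℂ) : Matrix n n ℂ := cfc (fun t : ℝ => t ^ (1 / 4 : ℝ)) β

/-- The scalar function `t ↦ t ^ (-1/4)` with value `0` at `0`. -/
def invFourthRootFun (t : ℝ) : ℝ := if t = 0 then 0 else t ^ (-(1 / 4) : ℝ)

lemma invFourthRootFun_mul {s t : ℝ} (hs : 0 ≤ s) (ht : 0 ≤ t) :
    invFourthRootFun (s * t) = invFourthRootFun s * invFourthRootFun t := by
  simp only [invFourthRootFun, mul_eq_zero]
  by_cases h1 : s = 0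
  · simp [h1]
  by_cases h2 : t = 0
  · simp [h2]
  simp [h1, h2, Real.mul_rpow hs ht]

lemma invFourthRootFun_pow_four {t : ℝ} (ht : 0 ≤ t) : invFourthRootFun t ^ 4 = t⁻¹ := by
  simp only [invFourthRootFun]
  split_ifs with h
  · simp [h]
  · rw [← Real.rpow_natCast, ← Real.rpow_mul ht]
    norm_num
    rw [Real.rpow_neg_one]

lemma rpow_quarter_pow_four {t : ℝ} (ht : 0 ≤ t) :
    t ^ (1 / 4 : ℝ) * t ^ (1 / 4 : ℝ) * (t ^ (1 / 4 : ℝ) * t ^ (1 / 4 : ℝ)) = t := by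
  have : (t ^ (1 / 4 : ℝ)) ^ 4 = t := by
    rw [← Real.rpow_natCast, ← Real.rpow_mul ht]
    norm_num
  nlinarith [this]

lemma rpow_quarter_mul_invFourthRootFun_mul {t : ℝ} (ht : 0 ≤ t) :
    t ^ (1 / 4 : ℝ) * invFourthRootFun t * t = t := by
  simp only [invFourthRootFun]
  split_ifs with h
  · simp [h]
  · rw [← Real.rpow_add (lt_of_le_of_ne ht (Ne.symm h))]
    norm_num

lemma PosSemidef.exists_diagonalization {R : Matrix n n ℂ} (hR : R.PosSemidef) :
    ∃ V ∈ unitaryGroup n ℂ, ∃ e : n → ℝ, (∀ i, 0 ≤ e i) ∧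
      R = V * diagonal (fun i => (e i : ℂ)) * Vᴴ := by
  obtain ⟨V, hV, h⟩ := SoftCovering.exists_diagonalization hR.isHermitian
  exact ⟨V, hV, _, hR.eigenvalues_nonneg, h⟩

lemma conj_diagonal_mul {V : Matrix n n ℂ} (hV : V ∈ unitaryGroup n ℂ) (a b : n → ℝ) :
    (V * diagonal (fun i => (a i : ℂ)) * Vᴴ) * (V * diagonal (fun i => (b i : ℂ)) * Vᴴ)
      = V * diagonal (fun i => ((a i * b i : ℝ) : ℂ)) * Vᴴ := by
  have hV1 : Vᴴ * V = 1 := mem_unitaryGroup_iff'.1 hV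
  calc _ = V * diagonal (fun i => (a i : ℂ)) * (Vᴴ * V)
          * diagonal (fun i => (b i : ℂ)) * Vᴴ := by simp only [mul_assoc]
    _ = _ := by
      rw [hV1, mul_one, mul_assoc V, diagonal_mul_diagonal]
      push_cast
      rfl

lemma conj_diagonal_isHermitian (V : Matrix n n ℂ) (a : n → ℝ) :
    (V * diagonal (fun i => (a i : ℂ)) * Vᴴ).IsHermitian := by
  rw [IsHermitian, conjTranspose_mul, conjTranspose_mul, conjTranspose_conjTranspose,
    diagonal_conjTranspose, mul_assoc]
  congr 3
  ext i
  simp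

section PosSemidef

variable {R : Matrix n n ℂ}

lemma fourthRoot_isHermitian (hR : R.PosSemidef) : (fourthRoot R).IsHermitian := by
  obtain ⟨V, hV, e, -, rfl⟩ := PosSemidef.exists_diagonalization hR
  rw [fourthRoot, cfc_eq_of_diagonalization hV]
  exact conj_diagonal_isHermitian _ _

lemma invFourthRoot_isHermitian (hR : R.PosSemidef) : (invFourthRoot R).IsHermitian := by
  obtain ⟨V, hV, e, -, rfl⟩ := PosSemidef.exists_diagonalization hR
  rw [invFourthRoot, cfc_eq_of_diagonalization hV]
  exact conj_diagonal_isHermitian _ _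

lemma fourthRoot_pow_four (hR : R.PosSemidef) :
    fourthRoot R * fourthRoot R * (fourthRoot R * fourthRoot R) = R := by
  obtain ⟨V, hV, e, he, rfl⟩ := PosSemidef.exists_diagonalization hR
  rw [fourthRoot, cfc_eq_of_diagonalization hV, conj_diagonal_mul hV, conj_diagonal_mul hV]
  simp only [rpow_quarter_pow_four (he _)]

/-- The product of the two roots is the projection onto the support of `R`. -/
lemma fourthRoot_mul_invFourthRoot_mul (hR : R.PosSemidef) :
    fourthRoot R * invFourthRoot R * R = R := by
  obtain ⟨V, hV, e, he, h⟩ := PosSemidef.exists_diagonalization hR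
  conv_lhs =>
    rw [fourthRoot, invFourthRoot, h, cfc_eq_of_diagonalization hV, cfc_eq_of_diagonalization hV,
      conj_diagonal_mul hV, conj_diagonal_mul hV]
  conv_rhs => rw [h]
  congr 3
  ext i
  exact congrArg _ (rpow_quarter_mul_invFourthRootFun_mul (he i))

lemma invFourthRoot_kronecker (hR : R.PosSemidef) {Y : Type*} [Fintype Y] [DecidableEq Y]
    {c : Y → ℝ} (hc : ∀ u, 0 ≤ c u) :
    invFourthRoot (diagonal (fun u => (c u : ℂ)) ⊗ₖ R)
      = diagonal (fun u => (invFourthRootFun (c u) : ℂ)) ⊗ₖ invFourthRoot R := by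
  obtain ⟨V, hV, e, he, rfl⟩ := PosSemidef.exists_diagonalization hR
  have hW : (1 : Matrix Y Y ℂ) ⊗ₖ V ∈ unitaryGroup (Y × n) ℂ :=
    kronecker_mem_unitary (one_mem _) hV
  have key : ∀ (a : Y → ℝ) (b : n → ℝ), diagonal (fun u => (a u : ℂ)) ⊗ₖ
      (V * diagonal (fun i => (b i : ℂ)) * Vᴴ)
      = ((1 : Matrix Y Y ℂ) ⊗ₖ V) * diagonal (fun p : Y × n => ((a p.1 * b p.2 : ℝ) : ℂ))
        * ((1 : Matrix Y Y ℂ) ⊗ₖ V)ᴴ := by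
    intro a b
    rw [conjTranspose_kronecker, conjTranspose_one]
    push_cast
    rw [← diagonal_kronecker_diagonal (fun u => (a u : ℂ)) (fun i => (b i : ℂ)),
      ← mul_kronecker_mul, ← mul_kronecker_mul, one_mul, mul_one]
  rw [key, invFourthRoot, cfc_eq_of_diagonalization hW, invFourthRoot,
    cfc_eq_of_diagonalization hV, key]
  congr 3
  ext p
  exact congrArg _ (invFourthRootFun_mul (hc _) (he _))

/-- With `r = R^(1/4)` and `B = r C r`, cyclicity gives `Tr(UB) = Tr(rUr C)`. Cauchy–Schwarz leaves
`‖rUr‖₂² = Tr(r² U†r²U)`, and a second Cauchy–Schwarz bounds this by `Tr r⁴ = Tr R`. -/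
lemma traceSeminorm_le_sqrt_mul (hR : R.PosSemidef) {B : Matrix n n ℂ}
    (hB : fourthRoot R * (invFourthRoot R * B * invFourthRoot R) * fourthRoot R = B) :
    traceSeminorm n B ≤
      Real.sqrt R.trace.re * schattenTwo (invFourthRoot R * B * invFourthRoot R) := by
  refine traceSeminorm_le fun U hU => ?_
  set r := fourthRoot R
  have hr : rᴴ = r := fourthRoot_isHermitian hR
  set C := invFourthRoot R * B * invFourthRoot R with hC
  have hU2 : U * Uᴴ = 1 := mem_unitaryGroup_iff.1 hU
  have h1 : (U * B).trace = ((r * U * r) * C).trace := by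
    rw [← hB, ← mul_assoc, ← mul_assoc, trace_mul_comm]
    simp only [mul_assoc]
  rw [h1]
  refine (abs_re_trace_mul_le _ _).trans (mul_le_mul_of_nonneg_right ?_ (schattenTwo_nonneg _))
  refine Real.sqrt_le_sqrt ?_
  have hrr : ((r * r)ᴴ * (r * r)).trace.re = R.trace.re := by
    rw [conjTranspose_mul, hr, fourthRoot_pow_four hR]
  have h2 : schattenTwo (r * r) = Real.sqrt R.trace.re := by rw [schattenTwo, hrr]
  have h3 : schattenTwo (Uᴴ * (r * r) * U) = Real.sqrt R.trace.re := by
    rw [schattenTwo, ← hrr]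
    congr 2
    rw [conjTranspose_mul, conjTranspose_mul, conjTranspose_conjTranspose]
    calc _ = (Uᴴ * ((r * r)ᴴ * (U * Uᴴ) * (r * r)) * U).trace := by simp only [mul_assoc]
      _ = _ := by
        rw [hU2, mul_one, trace_mul_comm, ← mul_assoc, hU2, one_mul]
  have h4 : ((r * U * r)ᴴ * (r * U * r)).trace = ((r * r) * (Uᴴ * (r * r) * U)).trace := by
    rw [conjTranspose_mul, conjTranspose_mul, hr]
    calc _ = ((r * (Uᴴ * r * (r * U))) * r).trace := by simp only [mul_assoc]
      _ = _ := by
        rw [trace_mul_comm]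
        simp only [mul_assoc]
  rw [h4]
  refine (le_abs_self _).trans ((abs_re_trace_mul_le _ _).trans_eq ?_)
  rw [h2, h3, Real.mul_self_sqrt]
  have := hR.trace_nonneg
  exact (Complex.nonneg_iff.1 this).1

end PosSemidef

end Roots

/-! ### Diagonal blocks of matrices on a classical register times `M`. -/

section Blocks

open Matrix

variable {Y : Type*} [Fintype Y] [DecidableEq Y] {n : Type*} [Fintype n] [DecidableEq n]

/-- The diagonal block at `u` of a matrix on `Y × n`. -/
def block (α : Matrix (Y × n) (Y × n) ℂ) (u : Y) : Matrix n n ℂ :=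
  α.submatrix (Prod.mk u) (Prod.mk u)

lemma block_isHermitian {α : Matrix (Y × n) (Y × n) ℂ} (hα : α.IsHermitian) (u : Y) :
    (block α u).IsHermitian :=
  hα.submatrix _

lemma sum_schattenOne_block_le {α : Matrix (Y × n) (Y × n) ℂ} (hα : α.IsHermitian) :
    ∑ u, schattenOne (block α u) ≤ schattenOne α := by
  choose U hU hUt using fun u => exists_unitary_re_trace_eq (block_isHermitian hα u)
  -- The optimal unitaries of the blocks assemble into one test unitary for `α`, which need not be
  -- block diagonal. The swap is needed because `blockDiagonal` puts the block index second.
  let W : Matrix (Y × n) (Y × n) ℂ := (blockDiagonal U).submatrix Prod.swap Prod.swap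
  have hW : W ∈ unitaryGroup (Y × n) ℂ := by
    rw [mem_unitaryGroup_iff, star_eq_conjTranspose, conjTranspose_submatrix,
      blockDiagonal_conjTranspose]
    change ((blockDiagonal U).submatrix (Equiv.prodComm Y n) (Equiv.prodComm Y n)) *
      ((blockDiagonal fun k => (U k)ᴴ).submatrix (Equiv.prodComm Y n) (Equiv.prodComm Y n)) = 1
    rw [submatrix_mul_equiv, ← blockDiagonal_mul]
    simp only [show ∀ u, U u * (U u)ᴴ = 1 from fun u => mem_unitaryGroup_iff.1 (hU u)]
    change (blockDiagonal (1 : Y → Matrix n n ℂ)).submatrix _ _ = 1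
    rw [blockDiagonal_one, submatrix_one_equiv]
  have h : (W * α).trace = ∑ u, (U u * block α u).trace := by
    simp only [Matrix.trace, Matrix.diag_apply, Matrix.mul_apply, Fintype.sum_prod_type]
    refine Finset.sum_congr rfl fun u _ => Finset.sum_congr rfl fun a _ => ?_
    simp [W, block, blockDiagonal_apply]
  rw [schattenOne_eq_traceSeminorm hα]
  refine le_trans ?_ (abs_re_trace_unitary_mul_le hW α)
  rw [h, Complex.re_sum]
  simp only [hUt]
  exact le_abs_self _

lemma diagonal_kronecker_mul_apply (d : Y → ℂ) (P : Matrix n n ℂ) (α : Matrix (Y × n) (Y × n) ℂ)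
    (u : Y) (a : n) (z : Y × n) :
    ((diagonal d ⊗ₖ P) * α) (u, a) z = d u * ∑ b, P a b * α (u, b) z := by
  simp only [Matrix.mul_apply, Fintype.sum_prod_type, kroneckerMap_apply, diagonal_apply, ite_mul,
    zero_mul]
  rw [Finset.sum_eq_single u]
  · simp [Finset.mul_sum, mul_assoc]
  · intro v _ hv
    simp [hv.symm]
  · simp

lemma mul_diagonal_kronecker_apply (d : Y → ℂ) (P : Matrix n n ℂ) (α : Matrix (Y × n) (Y × n) ℂ)
    (u : Y) (a : n) (z : Y × n) :
    (α * (diagonal d ⊗ₖ P)) z (u, a) = d u * ∑ b, α z (u, b) * P b a := by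
  simp only [Matrix.mul_apply, Fintype.sum_prod_type, kroneckerMap_apply, diagonal_apply, ite_mul,
    zero_mul]
  rw [Finset.sum_eq_single u]
  · simp only [if_true, Finset.mul_sum]
    exact Finset.sum_congr rfl fun _ _ => by ring
  · intro v _ hv
    simp [hv]
  · simp

lemma block_diagonal_kronecker_mul (d : Y → ℂ) (P : Matrix n n ℂ)
    (α : Matrix (Y × n) (Y × n) ℂ) (u : Y) :
    block ((diagonal d ⊗ₖ P) * α) u = d u • (P * block α u) := by
  ext a b
  rw [block, submatrix_apply, diagonal_kronecker_mul_apply]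
  simp [block, Matrix.mul_apply]

lemma block_mul_diagonal_kronecker (d : Y → ℂ) (P : Matrix n n ℂ)
    (α : Matrix (Y × n) (Y × n) ℂ) (u : Y) :
    block (α * (diagonal d ⊗ₖ P)) u = d u • (block α u * P) := by
  ext a b
  rw [block, submatrix_apply, mul_diagonal_kronecker_apply]
  simp [block, Matrix.mul_apply]

lemma sum_schattenTwo_sq_block_le (α : Matrix (Y × n) (Y × n) ℂ) :
    ∑ u, schattenTwo (block α u) ^ 2 ≤ schattenTwo α ^ 2 := by
  simp only [schattenTwo_sq, Fintype.sum_prod_type]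
  refine Finset.sum_le_sum fun u _ => Finset.sum_le_sum fun a _ => ?_
  exact Finset.single_le_sum (f := fun v => ∑ b, ‖α (u, a) (v, b)‖ ^ 2)
    (fun v _ => by positivity) (Finset.mem_univ u)

lemma mul_eq_of_supp_le {n : Type*} [Fintype n] [DecidableEq n] {α β P : Matrix n n ℂ}
    (h : supp α ≤ supp β) (hP : P * β = β) : P * α = α := by
  refine Matrix.toLin'.injective (LinearMap.ext fun v => ?_)
  obtain ⟨w, hw⟩ := h ⟨v, rfl⟩
  rw [Matrix.toLin'_mul, LinearMap.comp_apply, ← hw, ← LinearMap.comp_apply, ← Matrix.toLin'_mul,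
    hP]

lemma schattenTwo_smul (c : ℂ) (A : Matrix n n ℂ) : schattenTwo (c • A) = ‖c‖ * schattenTwo A := by
  rw [← sq_eq_sq₀ (schattenTwo_nonneg _) (by have := schattenTwo_nonneg A; positivity), mul_pow,
    schattenTwo_sq, schattenTwo_sq]
  simp [Finset.mul_sum, mul_pow]

variable {R : Matrix n n ℂ} {c : Y → ℝ} {α : Matrix (Y × n) (Y × n) ℂ}

/-- The support projection of the product state fixes its range, hence fixes `α`; reading this
identity block by block gives both claims. -/
lemma block_of_supp_le (hR : R.PosSemidef)
    (h : supp α ≤ supp (diagonal (fun u => (c u : ℂ)) ⊗ₖ R)) (u : Y) :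
    fourthRoot R * invFourthRoot R * block α u = block α u ∧ (c u = 0 → block α u = 0) := by
  let d : Y → ℂ := fun u => if c u = 0 then 0 else 1
  have h1 : (diagonal d ⊗ₖ (fourthRoot R * invFourthRoot R)) * (diagonal (fun u => (c u : ℂ)) ⊗ₖ R)
      = diagonal (fun u => (c u : ℂ)) ⊗ₖ R := by
    rw [← mul_kronecker_mul, fourthRoot_mul_invFourthRoot_mul hR, diagonal_mul_diagonal]
    congr 2
    ext u
    by_cases hu : c u = 0 <;> simp [d, hu]
  have h2 := congrArg (fun M => block M u) (mul_eq_of_supp_le h h1)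
  simp only [block_diagonal_kronecker_mul] at h2
  by_cases hu : c u = 0
  · have h3 : block α u = 0 := by rw [← h2]; simp [d, hu]
    simp [h3]
  · exact ⟨by simpa [d, hu] using h2, fun h => absurd h hu⟩

lemma fourthRoot_conj_block (hR : R.PosSemidef) (hα : α.IsHermitian)
    (h : supp α ≤ supp (diagonal (fun u => (c u : ℂ)) ⊗ₖ R)) (u : Y) :
    fourthRoot R * (invFourthRoot R * block α u * invFourthRoot R) * fourthRoot R = block α u := by
  have h1 := (block_of_supp_le hR h u).1
  have hb : (block α u)ᴴ = block α u := block_isHermitian hα u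
  have h2 : block α u * (invFourthRoot R * fourthRoot R) = block α u := by
    have := congrArg conjTranspose h1
    rwa [conjTranspose_mul, conjTranspose_mul, hb, (fourthRoot_isHermitian hR).eq,
      (invFourthRoot_isHermitian hR).eq] at this
  calc _ = (fourthRoot R * invFourthRoot R * block α u) * (invFourthRoot R * fourthRoot R) := by
        simp only [mul_assoc]
    _ = _ := by rw [h1, h2]

/-- Each block picks up `c^(-1/4)` on both sides, hence `c⁻¹` after squaring, also at `c = 0` by the
conventions for inverses. Off-diagonal blocks are discarded. -/
lemma sum_inv_mul_schattenTwo_sq_le (hR : R.PosSemidef) (hc : ∀ u, 0 ≤ c u) :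
    ∑ u, (c u)⁻¹ * schattenTwo (invFourthRoot R * block α u * invFourthRoot R) ^ 2
      ≤ schattenTwo (invFourthRoot (diagonal (fun u => (c u : ℂ)) ⊗ₖ R) * α *
          invFourthRoot (diagonal (fun u => (c u : ℂ)) ⊗ₖ R)) ^ 2 := by
  refine le_trans (Finset.sum_le_sum fun u _ => ?_) (sum_schattenTwo_sq_block_le _)
  rw [invFourthRoot_kronecker hR hc, block_mul_diagonal_kronecker, block_diagonal_kronecker_mul,
    smul_mul, smul_smul, schattenTwo_smul, mul_pow]
  refine (congrArg (· * _) ?_).le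
  rw [← invFourthRootFun_pow_four (hc u), norm_mul, Complex.norm_real, Real.norm_eq_abs,
    abs_mul_abs_self]
  ring

end Blocks

/-! ### Reduced states of the control state. -/

section ControlState

variable {k : ℕ} {X : Fin k → Type*} [∀ i, Fintype (X i)] [∀ i, DecidableEq (X i)]
variable {m : Type*} [Fintype m] [DecidableEq m]
variable {p : (∀ i, X i) → ℝ} {ρ : (∀ i, X i) → Matrix m m ℂ}

lemma controlState_apply (x y : ∀ i, X i) (a b : m) :
    controlState p ρ (x, a) (y, b) = if x = y then (p x : ℂ) * ρ x a b else 0 := by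
  simp only [controlState, Matrix.sum_apply, Matrix.smul_apply, Matrix.kroneckerMap_apply,
    Matrix.single_apply, smul_eq_mul]
  rw [Finset.sum_eq_single x]
  · by_cases h : x = y <;> simp [h]
  · intro z _ hz
    simp [hz]
  · simp

lemma reduceToM_controlState : reduceToM (controlState p ρ) = ∑ x, p x • ρ x := by
  ext a b
  simp [reduceToM, controlState_apply, Matrix.sum_apply]

lemma trace_reduceToM (M : Matrix ((∀ i, X i) × m) ((∀ i, X i) × m) ℂ) :
    (reduceToM M).trace = M.trace := by
  simp only [Matrix.trace, Matrix.diag_apply, reduceToM, Matrix.of_apply]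
  rw [Fintype.sum_prod_type_right]

lemma trace_reduceTo (S : Finset (Fin k)) (M : Matrix ((∀ i, X i) × m) ((∀ i, X i) × m) ℂ) :
    (reduceTo S M).trace = M.trace := by
  simp only [Matrix.trace, Matrix.diag_apply, reduceTo, Matrix.of_apply]
  rw [Fintype.sum_prod_type, Fintype.sum_prod_type]
  rw [← (Equiv.piEquivPiSubtypeProd (· ∈ S) X).symm.sum_comp, Fintype.sum_prod_type]
  exact Finset.sum_congr rfl fun u _ => Finset.sum_comm

lemma reduceTo_isHermitian (S : Finset (Fin k)) {M : Matrix ((∀ i, X i) × m) ((∀ i, X i) × m) ℂ}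
    (hM : M.IsHermitian) : (reduceTo S M).IsHermitian := by
  ext u v
  simp only [reduceTo, Matrix.conjTranspose_apply, Matrix.of_apply, star_sum]
  exact Finset.sum_congr rfl fun z _ => hM.apply _ _

lemma controlState_isHermitian (hρ : ∀ x, (ρ x).IsHermitian) :
    (controlState p ρ).IsHermitian := by
  ext ⟨x, a⟩ ⟨y, b⟩
  rw [Matrix.conjTranspose_apply, controlState_apply, controlState_apply]
  by_cases h : x = y
  · subst h
    simpa using Or.inl ((hρ x).apply a b)
  · simp [h, Ne.symm h]

lemma block_reduceTo_controlState (S : Finset (Fin k)) (u : ∀ i : {i // i ∈ S}, X i) :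
    block (reduceTo S (controlState p ρ)) u
      = ∑ z : (∀ i : {i // i ∉ S}, X i),
          p ((Equiv.piEquivPiSubtypeProd (· ∈ S) X).symm (u, z)) •
            ρ ((Equiv.piEquivPiSubtypeProd (· ∈ S) X).symm (u, z)) := by
  ext a b
  simp [block, reduceTo, controlState_apply, Matrix.sum_apply]

end ControlState

/-! ### Restricting product weights to the coordinates in `S`. -/

section Marginals

variable {ι : Type*} [Fintype ι] [DecidableEq ι] {X : ι → Type*} [∀ i, Fintype (X i)]
variable {q : ∀ i, X i → ℝ}

lemma weight_piEquivPiSubtypeProd_symm (S : Finset ι) (u : ∀ i : {i // i ∈ S}, X i)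
    (z : ∀ i : {i // i ∉ S}, X i) :
    weight q ((Equiv.piEquivPiSubtypeProd (· ∈ S) X).symm (u, z))
      = weight (fun i : {i // i ∈ S} => q i) u * weight (fun i : {i // i ∉ S} => q i) z := by
  simp only [weight]
  rw [← Fintype.prod_subtype_mul_prod_subtype (· ∈ S)]
  congr 1
  · refine Finset.prod_congr (by ext; simp) fun i _ => ?_
    simp [Equiv.piEquivPiSubtypeProd, i.2]
  · refine Finset.prod_congr rfl fun i _ => ?_
    simp [Equiv.piEquivPiSubtypeProd, i.2]

lemma sum_weight_restrict (hq : ∀ i, ∑ a, q i a = 1) (S : Finset ι)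
    (φ : (∀ i : {i // i ∈ S}, X i) → ℝ) :
    ∑ y, weight q y * φ (fun i => y i) = ∑ u, weight (fun i : {i // i ∈ S} => q i) u * φ u := by
  rw [← (Equiv.piEquivPiSubtypeProd (· ∈ S) X).symm.sum_comp, Fintype.sum_prod_type]
  refine Finset.sum_congr rfl fun u _ => ?_
  have h : ∀ z, (fun i : {i // i ∈ S} => (Equiv.piEquivPiSubtypeProd (· ∈ S) X).symm (u, z) i)
      = u := by
    intro z
    ext i
    simp [Equiv.piEquivPiSubtypeProd, i.2]
  simp only [weight_piEquivPiSubtypeProd_symm, h]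
  rw [← Finset.sum_mul, ← Finset.mul_sum, sum_weight fun _ => hq _, mul_one]

lemma weight_restrict_smul_average (hq : ∀ i, ∑ a, q i a = 1) {E : Type*} [AddCommGroup E]
    [Module ℝ E] (S : Finset ι) (f : (∀ i, X i) → E) (y : ∀ i, X i) :
    weight (fun i : {i // i ∈ S} => q i) (fun i => y i) • average q S f y
      = ∑ z : (∀ i : {i // i ∉ S}, X i),
          weight q ((Equiv.piEquivPiSubtypeProd (· ∈ S) X).symm (fun i => y i, z)) •
            f ((Equiv.piEquivPiSubtypeProd (· ∈ S) X).symm (fun i => y i, z)) := by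
  have h : ∀ u z, S.piecewise y ((Equiv.piEquivPiSubtypeProd (· ∈ S) X).symm (u, z))
      = (Equiv.piEquivPiSubtypeProd (· ∈ S) X).symm (fun i => y i, z) := by
    intro u z
    ext i
    by_cases hi : i ∈ S <;> simp [Equiv.piEquivPiSubtypeProd, hi]
  rw [average, ← (Equiv.piEquivPiSubtypeProd (· ∈ S) X).symm.sum_comp,
    Fintype.sum_prod_type_right, Finset.smul_sum]
  refine Finset.sum_congr rfl fun z _ => ?_
  simp only [h, weight_piEquivPiSubtypeProd_symm]
  rw [← Finset.sum_smul, ← Finset.sum_mul, sum_weight fun _ => hq _, one_mul, smul_smul]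

end Marginals

/-! ### The covering error, one Hoeffding component at a time. -/

section Covering

variable {k : ℕ} {X : Fin k → Type*} [∀ i, Fintype (X i)] [∀ i, DecidableEq (X i)]
variable {m : Type*} [Fintype m] [DecidableEq m]
variable {q : ∀ i, X i → ℝ} {A : Fin k → ℕ}

/-- The average of `f` over all tuples of samples. -/
def tupleAverage {E : Type*} [AddCommGroup E] [Module ℝ E] (f : (∀ i, X i) → E)
    (x : ∀ i, Fin (A i) → X i) : E :=
  (∏ i, (A i : ℝ))⁻¹ • ∑ a : ∀ i, Fin (A i), f (fun i => x i (a i))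

lemma map_tupleAverage {E E' : Type*} [AddCommGroup E] [Module ℝ E] [AddCommGroup E'] [Module ℝ E']
    (L : E →ₗ[ℝ] E') (f : (∀ i, X i) → E) (x : ∀ i, Fin (A i) → X i) :
    L (tupleAverage f x) = tupleAverage (fun y => L (f y)) x := by
  simp [tupleAverage]

/-- The squared 2-norm is a sum over matrix entries, and Hoeffding components commute with linear
maps, so the scalar estimate applies entrywise. -/
lemma expectIID_schattenTwo_sq_le (hq0 : ∀ i a, 0 ≤ q i a) (hq : ∀ i, ∑ a, q i a = 1)
    (hA : ∀ i, 0 < A i) (S : Finset (Fin k)) (H : (∀ i, X i) → Matrix m m ℂ) :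
    expectIID q A (fun x => schattenTwo (tupleAverage (hoeffding q S H) x) ^ 2)
      ≤ (∏ i ∈ S, (A i : ℝ))⁻¹ * (4 ^ S.card * ∑ y, weight q y * schattenTwo (H y) ^ 2) := by
  have hentry : ∀ (a b : m) x, tupleAverage (hoeffding q S H) x a b
      = tupleAverage (A := A) (hoeffding q S fun y => H y a b) x := by
    intro a b x
    have h := map_tupleAverage (Matrix.entryLinearMap ℝ ℂ a b) (hoeffding q S H) x
    simp only [map_hoeffding] at h
    exact h
  simp only [schattenTwo_sq, hentry, expectIID_sum]
  have hsum : ∑ y, weight q y * ∑ a, ∑ b, ‖H y a b‖ ^ 2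
      = ∑ a, ∑ b, ∑ y, weight q y * ‖H y a b‖ ^ 2 := by
    simp only [Finset.mul_sum]
    rw [Finset.sum_comm]
    exact Finset.sum_congr rfl fun a _ => Finset.sum_comm
  rw [hsum]
  simp only [Finset.mul_sum (s := (Finset.univ : Finset m))]
  refine Finset.sum_le_sum fun a _ => Finset.sum_le_sum fun b _ => ?_
  refine (expectIID_norm_sq_average_le hq0 hq hA S _ fun i hi y =>
    sum_hoeffding_update hq hi _ y).trans ?_
  exact mul_le_mul_of_nonneg_left (sum_weight_norm_sq_hoeffding_le hq0 hq S _)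
    (inv_nonneg.2 (Finset.prod_nonneg fun i _ => Nat.cast_nonneg _))

lemma expectIID_traceSeminorm_le_sqrt (hq0 : ∀ i a, 0 ≤ q i a) (hq : ∀ i, ∑ a, q i a = 1)
    (hA : ∀ i, 0 < A i) (S : Finset (Fin k)) {R : Matrix m m ℂ} (hR : R.PosSemidef)
    {F : (∀ i, X i) → Matrix m m ℂ}
    (hF : ∀ y, fourthRoot R * (invFourthRoot R * F y * invFourthRoot R) * fourthRoot R = F y) :
    expectIID q A (fun x => traceSeminorm m (tupleAverage (hoeffding q S F) x))
      ≤ Real.sqrt R.trace.re * Real.sqrt ((∏ i ∈ S, (A i : ℝ))⁻¹ * (4 ^ S.card *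
          ∑ y, weight q y * schattenTwo (invFourthRoot R * F y * invFourthRoot R) ^ 2)) := by
  let L : Matrix m m ℂ →ₗ[ℝ] Matrix m m ℂ :=
    LinearMap.mulRight ℝ (invFourthRoot R) ∘ₗ LinearMap.mulLeft ℝ (invFourthRoot R)
  let L' : Matrix m m ℂ →ₗ[ℝ] Matrix m m ℂ :=
    LinearMap.mulRight ℝ (fourthRoot R) ∘ₗ LinearMap.mulLeft ℝ (fourthRoot R)
  have hL : ∀ x, invFourthRoot R * tupleAverage (hoeffding q S F) x * invFourthRoot R
      = tupleAverage (A := A) (hoeffding q S fun y => L (F y)) x := by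
    intro x
    have h := map_tupleAverage L (hoeffding q S F) x
    simp only [map_hoeffding] at h
    exact h
  have hL' : ∀ x, fourthRoot R * (invFourthRoot R * tupleAverage (hoeffding q S F) x *
      invFourthRoot R) * fourthRoot R = tupleAverage (A := A) (hoeffding q S F) x := by
    intro x
    have h := map_tupleAverage (L' ∘ₗ L) (hoeffding q S F) x
    simp only [map_hoeffding] at h
    rw [show (fun y => (L' ∘ₗ L) (F y)) = F from funext hF] at h
    exact h
  calc _ ≤ expectIID q A (fun x => Real.sqrt R.trace.re *
          schattenTwo (tupleAverage (hoeffding q S fun y => L (F y)) x)) :=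
        expectIID_mono hq0 fun x => by
          rw [← hL]
          exact traceSeminorm_le_sqrt_mul hR (hL' x)
    _ ≤ _ := by
        rw [expectIID_const_mul]
        refine mul_le_mul_of_nonneg_left ?_ (Real.sqrt_nonneg _)
        refine (expectIID_le_sqrt hq0 hq fun x => schattenTwo_nonneg _).trans ?_
        exact Real.sqrt_le_sqrt (expectIID_schattenTwo_sq_le hq0 hq hA S fun y => L (F y))

variable {p : (∀ i, X i) → ℝ} {ρ : (∀ i, X i) → Matrix m m ℂ}

/-- The summand `p(y) / q(y) • ρ_y` of the sample average. -/
def reweighted (p : (∀ i, X i) → ℝ) (q : ∀ i, X i → ℝ) (ρ : (∀ i, X i) → Matrix m m ℂ)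
    (y : ∀ i, X i) : Matrix m m ℂ :=
  (p y / weight q y) • ρ y

lemma weight_smul_reweighted (hac : ∀ y, weight q y = 0 → p y = 0) (y : ∀ i, X i) :
    weight q y • reweighted p q ρ y = p y • ρ y := by
  rw [reweighted, smul_smul]
  by_cases h : weight q y = 0
  · simp [h, hac y h]
  · rw [mul_div_cancel₀ _ h]

lemma eq_zero_of_weight_eq_zero (hp : ∀ y, 0 ≤ p y)
    (hsupp : ∀ i, Function.support (marginal p i) ⊆ Function.support (q i)) {y : ∀ i, X i}
    (hy : weight q y = 0) : p y = 0 := by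
  obtain ⟨i, -, hi⟩ := Finset.prod_eq_zero_iff.1 hy
  have h : marginal p i (y i) = 0 := by
    by_contra hne
    exact hsupp i hne hi
  exact (Finset.sum_eq_zero_iff_of_nonneg fun x _ => hp x).1 h y (by simp)

lemma sampleAverage_eq (x : ∀ i, Fin (A i) → X i) :
    sampleAverage p q ρ A x = tupleAverage (reweighted p q ρ) x := by
  ext a b
  simp [sampleAverage, tupleAverage, reweighted, weight, Matrix.sum_apply]

lemma tupleAverage_sub_mean (hq : ∀ i, ∑ a, q i a = 1) (hA : ∀ i, 0 < A i) {E : Type*}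
    [AddCommGroup E] [Module ℝ E] (f : (∀ i, X i) → E) (x : ∀ i, Fin (A i) → X i) :
    tupleAverage f x - ∑ y, weight q y • f y
      = ∑ S ∈ Finset.univ.erase ∅, tupleAverage (hoeffding q S f) x := by
  have hpos : 0 < ∏ i, (A i : ℝ) := Finset.prod_pos fun i _ => Nat.cast_pos.2 (hA i)
  have h0 : tupleAverage (hoeffding q ∅ f) x = ∑ y, weight q y • f y := by
    simp only [tupleAverage, hoeffding_empty]
    rw [Finset.sum_const, Finset.card_univ, Fintype.card_pi]
    simp only [Fintype.card_fin]
    rw [← Nat.cast_smul_eq_nsmul ℝ, smul_smul]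
    push_cast
    rw [inv_mul_cancel₀ hpos.ne', one_smul]
  have h1 : tupleAverage f x = ∑ S, tupleAverage (hoeffding q S f) x := by
    simp only [tupleAverage]
    rw [← Finset.smul_sum, Finset.sum_comm]
    simp only [sum_hoeffding hq]
  rw [h1, ← Finset.add_sum_erase _ _ (Finset.mem_univ ∅), h0, add_sub_cancel_left]

/-- The first term is the price of replacing the reduced state by `α`, controlled in trace norm; the
second is the fluctuation of the smoothed part, controlled by its second moment. -/
lemma expectIID_component_le (hq0 : ∀ i a, 0 ≤ q i a) (hq : ∀ i, ∑ a, q i a = 1)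
    (hA : ∀ i, 0 < A i) (hac : ∀ y, weight q y = 0 → p y = 0)
    (hρ : ∀ x, (ρ x).IsHermitian) (S : Finset (Fin k)) {R : Matrix m m ℂ} (hR : R.PosSemidef)
    {α : Matrix ((∀ i : {i // i ∈ S}, X i) × m) ((∀ i : {i // i ∈ S}, X i) × m) ℂ}
    (hα : α.IsHermitian)
    (hsupp : supp α ≤ supp (Matrix.kroneckerMap (· * ·) (productState q S) R)) :
    expectIID q A (fun x => traceSeminorm m (tupleAverage (hoeffding q S (reweighted p q ρ)) x))
      ≤ 2 ^ S.card * schattenOne (α - reduceTo S (controlState p ρ))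
        + Real.sqrt R.trace.re * Real.sqrt ((∏ i ∈ S, (A i : ℝ))⁻¹ * (4 ^ S.card *
          schattenTwo (invFourthRoot (Matrix.kroneckerMap (· * ·) (productState q S) R) * α *
            invFourthRoot (Matrix.kroneckerMap (· * ·) (productState q S) R)) ^ 2)) := by
  set f := reweighted p q ρ with hf
  let c : (∀ i : {i // i ∈ S}, X i) → ℝ := weight fun i : {i // i ∈ S} => q i
  have hc : ∀ u, 0 ≤ c u := weight_nonneg fun _ => hq0 _
  -- `F` is the counterpart for `α` of the conditional average of `f`; where `c` vanishes it takes
  -- the value `0`.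
  let F : (∀ i, X i) → Matrix m m ℂ := fun y => (c fun i => y i)⁻¹ • block α fun i => y i
  let γ := reduceTo S (controlState p ρ)
  have hγ : γ.IsHermitian := reduceTo_isHermitian S (controlState_isHermitian hρ)
  have havg : ∀ y, c (fun i => y i) • average q S f y = block γ (fun i => y i) := by
    intro y
    rw [weight_restrict_smul_average hq]
    simp only [hf, weight_smul_reweighted hac]
    exact (block_reduceTo_controlState S _).symm
  have hsplit : ∀ x : ∀ i, Fin (A i) → X i, tupleAverage (hoeffding q S f) x
      = tupleAverage (hoeffding q S (average q S f - F)) x + tupleAverage (hoeffding q S F) x := by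
    intro x
    simp only [tupleAverage, hoeffding_sub, hoeffding_average hq]
    rw [← smul_add, ← Finset.sum_add_distrib]
    simp
  have h1 : expectIID q A
      (fun x => traceSeminorm m (tupleAverage (hoeffding q S (average q S f - F)) x))
      ≤ 2 ^ S.card * schattenOne (α - γ) := by
    refine (expectIID_seminorm_average_le hq0 hq hA _ _).trans
      ((sum_weight_seminorm_hoeffding_le hq0 hq _ S _).trans
        (mul_le_mul_of_nonneg_left ?_ (by positivity)))
    refine le_trans ?_ (sum_schattenOne_block_le (hα.sub hγ))
    have h2 : ∀ y, weight q y * traceSeminorm m ((average q S f - F) y)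
        ≤ weight q y * ((c fun i => y i)⁻¹ * schattenOne (block (α - γ) fun i => y i)) := by
      intro y
      by_cases hy : weight q y = 0
      · simp [hy]
      have hcy : c (fun i => y i) ≠ 0 := by
        intro h0
        apply hy
        obtain ⟨i, -, hi⟩ := Finset.prod_eq_zero_iff.1 h0
        exact Finset.prod_eq_zero (Finset.mem_univ i.1) hi
      refine (congrArg (weight q y * ·) ?_).le
      have h3 : (average q S f - F) y
          = (c fun i => y i)⁻¹ • (block γ (fun i => y i) - block α fun i => y i) := by
        rw [smul_sub, ← havg, smul_smul, inv_mul_cancel₀ hcy, one_smul]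
        rfl
      rw [h3, map_smul_eq_mul, Real.norm_of_nonneg (inv_nonneg.2 (hc _)), map_sub_rev,
        schattenOne_eq_traceSeminorm (block_isHermitian (hα.sub hγ) _)]
      rfl
    refine (Finset.sum_le_sum fun y _ => h2 y).trans ?_
    rw [sum_weight_restrict hq S fun u => (c u)⁻¹ * schattenOne (block (α - γ) u)]
    refine Finset.sum_le_sum fun u _ => ?_
    rw [← mul_assoc]
    -- Only `c * c⁻¹ ≤ 1` is used, so points with `c u = 0` need no separate case.
    refine mul_le_of_le_one_left ?_ mul_inv_le_one
    rw [schattenOne_eq_traceSeminorm (block_isHermitian (hα.sub hγ) _)]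
    exact apply_nonneg _ _
  have h2 : expectIID q A (fun x => traceSeminorm m (tupleAverage (hoeffding q S F) x))
      ≤ Real.sqrt R.trace.re * Real.sqrt ((∏ i ∈ S, (A i : ℝ))⁻¹ * (4 ^ S.card *
          schattenTwo (invFourthRoot (Matrix.kroneckerMap (· * ·) (productState q S) R) * α *
            invFourthRoot (Matrix.kroneckerMap (· * ·) (productState q S) R)) ^ 2)) := by
    refine (expectIID_traceSeminorm_le_sqrt hq0 hq hA S hR fun y => ?_).trans ?_
    · simp only [F, Matrix.mul_smul, Matrix.smul_mul]
      exact congrArg _ (fourthRoot_conj_block hR hα hsupp _)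
    · refine mul_le_mul_of_nonneg_left (Real.sqrt_le_sqrt ?_) (Real.sqrt_nonneg _)
      refine mul_le_mul_of_nonneg_left ?_
        (inv_nonneg.2 (Finset.prod_nonneg fun i _ => Nat.cast_nonneg _))
      refine mul_le_mul_of_nonneg_left ?_ (by positivity)
      refine le_trans ?_ (sum_inv_mul_schattenTwo_sq_le hR hc)
      have h3 : ∀ y, schattenTwo (invFourthRoot R * F y * invFourthRoot R) ^ 2
          = (c fun i => y i)⁻¹ ^ 2 *
            schattenTwo (invFourthRoot R * block α (fun i => y i) * invFourthRoot R) ^ 2 := by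
        intro y
        have h4 : invFourthRoot R * F y * invFourthRoot R = (((c fun i => y i)⁻¹ : ℝ) : ℂ) •
            (invFourthRoot R * block α (fun i => y i) * invFourthRoot R) := by
          simp only [F, Matrix.mul_smul, Matrix.smul_mul, Complex.coe_smul]
        rw [h4, schattenTwo_smul, mul_pow, Complex.norm_real, Real.norm_eq_abs, sq_abs]
      simp only [h3]
      rw [sum_weight_restrict hq S fun u => (c u)⁻¹ ^ 2 *
        schattenTwo (invFourthRoot R * block α u * invFourthRoot R) ^ 2]
      refine Finset.sum_le_sum fun u _ => ?_
      rw [← mul_assoc]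
      refine mul_le_mul_of_nonneg_right ?_ (sq_nonneg _)
      rw [sq, ← mul_assoc]
      exact mul_le_of_le_one_left (inv_nonneg.2 (hc u)) mul_inv_le_one
  calc _ ≤ expectIID q A
            (fun x => traceSeminorm m (tupleAverage (hoeffding q S (average q S f - F)) x))
          + expectIID q A (fun x => traceSeminorm m (tupleAverage (hoeffding q S F) x)) := by
        simp only [hsplit]
        refine (expectIID_mono hq0 fun x => map_add_le_add (traceSeminorm m) _ _).trans_eq ?_
        simp only [expectIID, mul_add, Finset.sum_add_distrib]
    _ ≤ _ := add_le_add h1 h2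

end Covering

/-! ### From the rate condition to a smoothed state. -/

section Rate

variable {n : Type*} [Fintype n] [DecidableEq n]

lemma add_coe_lt_coe_iff {x : EReal} {c l : ℝ} :
    x + (c : EReal) < (l : EReal) ↔ x < ((l - c : ℝ) : EReal) := by
  induction x using EReal.rec with
  | bot =>
    rw [EReal.bot_add]
    exact iff_of_true (EReal.bot_lt_coe _) (EReal.bot_lt_coe _)
  | top => simp
  | coe r => norm_cast; exact lt_sub_iff_add_lt.symm

/-- A strict bound on an infimum yields a witness, so attainment is not needed. The value `⊥` occurs
when the weighted 2-norm is zero, where the bound is immediate; `⊤` is excluded, which gives the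
support inclusion. -/
lemma exists_of_smoothRenyiTwo_lt {ε : ℝ} {α β : Matrix n n ℂ} {l : ℝ}
    (h : smoothRenyiTwo ε α β < (l : EReal)) :
    ∃ α', IsSubnormalised α' ∧ schattenOne (α' - α) ≤ ε * α.trace.re ∧ supp α' ≤ supp β ∧
      schattenTwo (invFourthRoot β * α' * invFourthRoot β) ^ 2 < 2 ^ l := by
  simp only [smoothRenyiTwo, iInf_lt_iff, Set.mem_ofPred_eq] at h
  obtain ⟨α', ⟨h1, h2⟩, h3⟩ := h
  unfold renyiTwo at h3
  split_ifs at h3 with hs ht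
  · exact ⟨α', h1, h2, hs, by rw [ht, zero_pow two_ne_zero]; positivity⟩
  · refine ⟨α', h1, h2, hs, ?_⟩
    have hpos := lt_of_le_of_ne (schattenTwo_nonneg _) (Ne.symm ht)
    have h4 := EReal.coe_lt_coe_iff.1 h3
    rw [← Real.logb_lt_iff_lt_rpow one_lt_two (by positivity), Real.logb_pow]
    exact_mod_cast h4
  · simp at h3

lemma two_rpow_rate {κ : Type*} (S : Finset κ) {A : κ → ℕ} (hA : ∀ i, 0 < A i) {ε t : ℝ}
    (hε : 0 < ε) (ht : 0 < t) :
    (2 : ℝ) ^ (∑ s ∈ S, Real.logb 2 (A s) - (Real.logb 2 (ε ^ (-2 : ℤ)) + Real.logb 2 t⁻¹))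
      = (∏ s ∈ S, (A s : ℝ)) * (ε ^ 2 * t) := by
  have hA' : ∀ i, (0 : ℝ) < A i := fun i => Nat.cast_pos.2 (hA i)
  have hprod : 0 < ∏ s ∈ S, (A s : ℝ) := Finset.prod_pos fun i _ => hA' i
  rw [← Real.logb_prod S _ fun i _ => (hA' i).ne', ← Real.logb_mul (by positivity) (by positivity),
    ← Real.logb_div hprod.ne' (by positivity), Real.rpow_logb two_pos (by norm_num) (by positivity)]
  rw [zpow_neg, div_eq_mul_inv, mul_inv, inv_inv, inv_inv]
  norm_cast

end Rate

end SoftCovering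

end

open SoftCovering

theorem mainTheorem9
    (k : ℕ) (hk : 0 < k)
    (X : Fin k → Type*) [∀ i, Fintype (X i)] [∀ i, DecidableEq (X i)]
    (m : Type*) [Fintype m] [DecidableEq m]
    (p : (∀ i, X i) → ℝ) (hp : p ∈ stdSimplex ℝ (∀ i, X i))
    (q : ∀ i, X i → ℝ) (hq : ∀ i, q i ∈ stdSimplex ℝ (X i))
    (hsupp : ∀ i, Function.support (SoftCovering.marginal p i) ⊆ Function.support (q i))
    (ρ : (∀ i, X i) → Matrix m m ℂ) (hρ : ∀ x, SoftCovering.IsSubnormalised (ρ x))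
    (hpos : 0 < (SoftCovering.controlState p ρ).trace.re)
    (A : Fin k → ℕ) (hA : ∀ i, 0 < A i)
    (ε : ℝ) (hε : 0 < ε) (hε' : ε < 1)
    (hrate : ∀ S : Finset (Fin k), S.Nonempty →
      SoftCovering.smoothRenyiTwo ε
          (SoftCovering.reduceTo S (SoftCovering.controlState p ρ))
          (Matrix.kroneckerMap (· * ·) (SoftCovering.productState q S)
            (SoftCovering.reduceToM (SoftCovering.controlState p ρ)))
        + ((Real.logb 2 (ε ^ (-2 : ℤ))
            + Real.logb 2 ((SoftCovering.controlState p ρ).trace.re)⁻¹ : ℝ) : EReal)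
        < ((∑ s ∈ S, Real.logb 2 (A s) : ℝ) : EReal)) :
    SoftCovering.expectIID q A (fun x =>
        SoftCovering.schattenOne
          (SoftCovering.sampleAverage p q ρ A x
            - SoftCovering.reduceToM (SoftCovering.controlState p ρ)))
      < 2 * (3 ^ k - 1) * ε * (SoftCovering.controlState p ρ).trace.re := by
  have hq0 : ∀ i a, 0 ≤ q i a := fun i => (hq i).1
  have hq1 : ∀ i, ∑ a, q i a = 1 := fun i => (hq i).2
  have hac : ∀ y, weight q y = 0 → p y = 0 := fun y => eq_zero_of_weight_eq_zero hp.1 hsupp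
  have hH : ∀ x, (ρ x).IsHermitian := fun x => (hρ x).1.isHermitian
  set R := reduceToM (controlState p ρ) with hR
  set t := (controlState p ρ).trace.re with ht
  have htR : R.trace.re = t := by rw [hR, trace_reduceToM]
  have hRsum : R = ∑ y, weight q y • reweighted p q ρ y := by
    simp only [hR, reduceToM_controlState, weight_smul_reweighted hac]
  have hRpsd : R.PosSemidef := by
    rw [hR, reduceToM_controlState]
    exact Matrix.posSemidef_sum _ fun x _ => (hρ x).1.smul (hp.1 x)
  have hcomp : ∀ S ∈ Finset.univ.erase (∅ : Finset (Fin k)),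
      expectIID q A (fun x => traceSeminorm m (tupleAverage (hoeffding q S (reweighted p q ρ)) x))
        < 2 * 2 ^ S.card * (ε * t) := by
    intro S hS
    have hrS := add_coe_lt_coe_iff.1
      (hrate S (Finset.nonempty_iff_ne_empty.2 (Finset.ne_of_mem_erase hS)))
    obtain ⟨α, hα, hdist, hsup, hT⟩ := exists_of_smoothRenyiTwo_lt hrS
    rw [two_rpow_rate S hA hε hpos] at hT
    rw [trace_reduceTo] at hdist
    have hprod : 0 < ∏ i ∈ S, (A i : ℝ) := Finset.prod_pos fun i _ => Nat.cast_pos.2 (hA i)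
    refine (expectIID_component_le hq0 hq1 hA hac hH S hRpsd hα.1.isHermitian hsup).trans_lt ?_
    -- The sample sizes cancel: under the root remains less than `t · 4^|S| · ε² t`. The strict
    -- inequality of the theorem originates here.
    have hsq : Real.sqrt R.trace.re * Real.sqrt ((∏ i ∈ S, (A i : ℝ))⁻¹ * (4 ^ S.card *
        schattenTwo (invFourthRoot (Matrix.kroneckerMap (· * ·) (productState q S) R) * α *
          invFourthRoot (Matrix.kroneckerMap (· * ·) (productState q S) R)) ^ 2))
        < 2 ^ S.card * (ε * t) := by
      rw [htR, ← Real.sqrt_mul hpos.le, Real.sqrt_lt' (by positivity)]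
      calc _ < t * ((∏ i ∈ S, (A i : ℝ))⁻¹ * (4 ^ S.card *
            ((∏ i ∈ S, (A i : ℝ)) * (ε ^ 2 * t)))) := by gcongr
        _ = (2 ^ S.card * (ε * t)) ^ 2 := by
          have h4 : (4 : ℝ) ^ S.card = (2 ^ S.card) ^ 2 := by
            rw [← pow_mul, mul_comm, pow_mul]
            norm_num
          rw [h4]
          field_simp
    have hfirst := mul_le_mul_of_nonneg_left hdist (show (0 : ℝ) ≤ 2 ^ S.card by positivity)
    linarith
  -- Strictness survives the summation because `k > 0` provides a non-empty `S`.
  have hne : (Finset.univ.erase (∅ : Finset (Fin k))).Nonempty :=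
    ⟨{⟨0, hk⟩}, by simp⟩
  -- Binomial theorem for `(2 + 1)^k`, with the term of the empty set removed.
  have hcount : ∑ S ∈ Finset.univ.erase (∅ : Finset (Fin k)), (2 : ℝ) ^ S.card = 3 ^ k - 1 := by
    have h1 := Fintype.sum_pow_mul_eq_add_pow (Fin k) (2 : ℝ) 1
    simp only [one_pow, mul_one, Fintype.card_fin] at h1
    have h2 := Finset.add_sum_erase Finset.univ (fun S : Finset (Fin k) => (2 : ℝ) ^ S.card)
      (Finset.mem_univ ∅)
    rw [h1, Finset.card_empty, pow_zero, show (2 : ℝ) + 1 = 3 by norm_num] at h2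
    linarith
  have hpoint : ∀ x, schattenOne (sampleAverage p q ρ A x - R)
      ≤ ∑ S ∈ Finset.univ.erase ∅,
          traceSeminorm m (tupleAverage (hoeffding q S (reweighted p q ρ)) x) := by
    intro x
    have hherm : (sampleAverage p q ρ A x).IsHermitian := by
      rw [sampleAverage_eq]
      have hsa : IsSelfAdjoint (tupleAverage (reweighted p q ρ) x) :=
        (IsSelfAdjoint.all _).smul (isSelfAdjoint_sum _ fun a _ =>
          (IsSelfAdjoint.all _).smul (hH _).isSelfAdjoint)
      exact hsa.isHermitian
    rw [schattenOne_eq_traceSeminorm (hherm.sub hRpsd.isHermitian), sampleAverage_eq, hRsum,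
      tupleAverage_sub_mean hq1 hA]
    exact Finset.le_sum_of_subadditive _ (map_zero _).le (map_add_le_add _) _ _
  calc _ ≤ ∑ S ∈ Finset.univ.erase ∅, expectIID q A
          (fun x => traceSeminorm m (tupleAverage (hoeffding q S (reweighted p q ρ)) x)) := by
        rw [← expectIID_sum]
        exact expectIID_mono hq0 hpoint
    _ < ∑ S ∈ Finset.univ.erase (∅ : Finset (Fin k)), 2 * 2 ^ S.card * (ε * t) :=
        Finset.sum_lt_sum_of_nonempty hne hcomp
    _ = _ := by
        rw [← Finset.sum_mul, ← Finset.mul_sum, hcount]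
        ring
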